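/- Let $S^1=\mathbb R/10\mathbb Z$ with coordinate $\theta$, $F=[-1,1]\times S^1$ with coordinates $(r,\theta)$, and $I=[0,1]$. Let $W$ be obtained from two copies $W_s$ and $\bar W_s$ of $F\times[-1,1]$, with coordinates $(r,\theta,z)$, by gluing the top $F\times\{1\}$ of $W_s$ to the bottom $F\times\{-1\}$ of $\bar W_s$. Let $\mathcal W$ be the oriented one-dimensional foliation of $W$ whose leaves are the trajectories of $\frac{\partial}{\partial\theta}+(r^2+z^6)\frac{\partial}{\partial z}$ in $W_s$ and of $-\frac{\partial}{\partial\theta}+(r^2+z^6)\frac{\partial}{\partial z}$ in $\bar W_s$, joined along the common annulus. Let $\alpha_-,\alpha_+:F\to W$ be the identifications of $F$ with the bottom of $W_s$ and the top of $\bar W_s$ given by $\alpha_-(p)=(p,-1)\in W_s$ and $\alpha_+(p)=(p,1)\in\bar W_s$. With $0\le\theta<10$, let $D_s\subset F$ be the set of $(r,\theta)$ for which $\sigma(r,\theta)=(r-\frac14r^2-2(\theta-2)^2,\,6,\,2-\theta)$ lies in $W_s$, let $\bar D_s\subset F$ be the set of $(r,\theta)$ for which $\sigma(r,\theta)=(r-\frac14r^2-2(\theta-8)^2,\,4,\,\theta-8)$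 lies in $\bar W_s$, and put $D=D_s\cup\bar D_s$ (a disjoint union). These formulas define $\sigma:D\to W$. Let $N$ be an open neighborhood of $\partial(F\times I)$ in $F\times I$, and let $\alpha$ be a homeomorphism from $N$ onto an open neighborhood of $\partial W$ in $W$ that takes the fibers of $N$ over $F$ into leaves (continuously for the leaf topology) and satisfies $\alpha(p,0)=\alpha_-(p)$ and $\alpha(p,1)=\alpha_+(p)$. Extend $\sigma$ to an embedding $\sigma:D\times I\to W$, with $\sigma(p,0)=\sigma(p)$, which takes each fiber $\{p\}\times I$ into a leaf preserving orientation, and whose image is disjoint from $\alpha_-(F)$, from $\alpha_+(F)$, and from the closure of $\alpha((D\times I)\cap N)$. Let $\hat W$ be the space obtained from $W\setminus\sigma((D\times I)\setminus N)$ by identifying $\sigma(x)$ with $\alpha(x)$ for all $x\in(D\times I)\cap N$, with the foliation $\hat{\mathcal W}$ induced by $\mathcal W$. The self-inserted plug $\tilde{\mathcal W}$ is the restriction of $\hat{\mathcal W}$ to a part $\tilde W\subset\hat W$ that is cut out by surfaces transverse to $\hat{\mathcal W}$ approximating the stair-like top and bottom of $\hat W$. **Theorem.** The self-inserted plug $\tilde{\mathcal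 W}$ has no circular leaves, whatever choices of $N$, $\alpha$ and the extension of $\sigma$ are made. In fact, for every subset $Y\subseteq\hat W$, in particular for $Y=\tilde W$, no leaf of the restriction of $\hat{\mathcal W}$ to $Y$ (that is, no connected component of $Y$ in the leaf topology) is homeomorphic to a circle in the leaf topology. -/

import Mathlib

namespace AnalyticPlug

noncomputable section

open Set Topology

instance circumference_pos : Fact ((0 : ℝ) < 10) := ⟨by norm_num⟩

/-- The annulus `F = [-1,1] × S¹` with coordinates `(r, θ)`, where `S¹ = ℝ / 10ℤ`. -/
abbrev F : Type := Icc (-1 : ℝ) 1 × AddCircle (10 : ℝ)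

/-- The support of the concatenated plug: two copies of `F × [-1,1]`, the top of the first one glued
to the bottom of the second one. The height coordinate runs through `[-1,3]`; the first copy is
the part of height at most `1`, the second copy the part of height at least `1`. -/
abbrev W : Type := F × Icc (-1 : ℝ) 3

/-- The points `(r, θ, z)` with `θ` lifted to `ℝ` that describe points of one copy of
`F × [-1,1]`. -/
def box : Set (ℝ × ℝ × ℝ) := {x | x.1 ∈ Icc (-1 : ℝ) 1 ∧ x.2.2 ∈ Icc (-1 : ℝ) 1}

/-- The point of radius `r`, angle `θ` and height `h` (the clamping of `r` and `h` is irrelevant for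
the values in range, the only ones that are used). -/
def point (r θ h : ℝ) : W :=
  ((projIcc (-1) 1 (by norm_num) r, (θ : AddCircle (10 : ℝ))), projIcc (-1) 3 (by norm_num) h)

/-- The point `(r, θ, z)` of the lower copy of `F × [-1,1]`. -/
def lowerPoint (x : ℝ × ℝ × ℝ) : W := point x.1 x.2.1 x.2.2

/-- The point `(r, θ, z)` of the upper copy of `F × [-1,1]`. -/
def upperPoint (x : ℝ × ℝ × ℝ) : W := point x.1 x.2.1 (x.2.2 + 2)

/-- The vector field `∂/∂θ + (r² + z⁶) ∂/∂z`. -/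
def lowerField (x : ℝ × ℝ × ℝ) : ℝ × ℝ × ℝ := (0, 1, x.1 ^ 2 + x.2.2 ^ 6)

/-- The vector field `-∂/∂θ + (r² + z⁶) ∂/∂z`. -/
def upperField (x : ℝ × ℝ × ℝ) : ℝ × ℝ × ℝ := (0, -1, x.1 ^ 2 + x.2.2 ^ 6)

/-- `γ` restricted to `[a,b]` is an oriented trajectory of the concatenated plug: up to some time `m`
it is an integral curve of the lower field in the lower copy, and from then on an integral curve
of the upper field in the upper copy (one of the two parts may be missing, as `m` need not lie
in `[a,b]`). -/
def IsTrajectory (a b : ℝ) (γ : ℝ → W) : Prop :=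
  ∃ (m : ℝ) (c₁ c₂ : ℝ → ℝ × ℝ × ℝ),
    (∀ t ∈ Icc a b ∩ Iic m, c₁ t ∈ box ∧ γ t = lowerPoint (c₁ t) ∧
      HasDerivWithinAt c₁ (lowerField (c₁ t)) (Icc a b ∩ Iic m) t) ∧
    (∀ t ∈ Icc a b ∩ Ici m, c₂ t ∈ box ∧ γ t = upperPoint (c₂ t) ∧
      HasDerivWithinAt c₂ (upperField (c₂ t)) (Icc a b ∩ Ici m) t)

/-- The leaf topology of the plug: the finest topology for which all trajectories are
continuous. -/
@[reducible] def leafTopology : TopologicalSpace W :=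
  ⨆ (a : ℝ) (b : ℝ) (γ : ℝ → W) (_ : IsTrajectory a b γ),
    TopologicalSpace.coinduced (fun t : Icc a b => γ t) inferInstance

/-- The identification `α₋` of `F` with the bottom of the plug. -/
def bottom (p : F) : W := (p, ⟨-1, by norm_num⟩)

/-- The identification `α₊` of `F` with the top of the plug. -/
def top (p : F) : W := (p, ⟨3, by norm_num⟩)

/-- The boundary of the support of the plug. -/
def boundaryW : Set W :=
  {w | (w.1.1 : ℝ) = -1 ∨ (w.1.1 : ℝ) = 1 ∨ (w.2 : ℝ) = -1 ∨ (w.2 : ℝ) = 3}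

/-- The boundary of `F × I`. -/
def boundaryFI : Set (F × unitInterval) :=
  {x | (x.1.1 : ℝ) = -1 ∨ (x.1.1 : ℝ) = 1 ∨ x.2 = 0 ∨ x.2 = 1}

/-- The representative `0 ≤ θ < 10` of an angle. -/
def angle (x : AddCircle (10 : ℝ)) : ℝ := (AddCircle.equivIco (10 : ℝ) 0 x : ℝ)

/-- The formula `(r, θ) ↦ (r - r²/4 - 2(θ - 2)², 6, 2 - θ)`. -/
def lowerFormula (p : F) : ℝ × ℝ × ℝ :=
  ((p.1 : ℝ) - (1 / 4) * (p.1 : ℝ) ^ 2 - 2 * (angle p.2 - 2) ^ 2, 6, 2 - angle p.2)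

/-- The formula `(r, θ) ↦ (r - r²/4 - 2(θ - 8)², 4, θ - 8)`. -/
def upperFormula (p : F) : ℝ × ℝ × ℝ :=
  ((p.1 : ℝ) - (1 / 4) * (p.1 : ℝ) ^ 2 - 2 * (angle p.2 - 8) ^ 2, 4, angle p.2 - 8)

/-- The first component of the domain of the self-insertion map. -/
def lowerDomain : Set F := {p | lowerFormula p ∈ box}

/-- The second component of the domain of the self-insertion map. -/
def upperDomain : Set F := {p | upperFormula p ∈ box}

/-- The domain `D` of the self-insertion map, the union of two disjoint components. -/
def D : Set F := lowerDomain ∪ upperDomain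

open Classical in
/-- The self-insertion map `σ`, which is only used on `D`. It sends the first component of `D` to the
lower copy and the second one to the upper copy. -/
def sigma (p : F) : W :=
  if p ∈ lowerDomain then lowerPoint (lowerFormula p) else upperPoint (upperFormula p)

/-- The part `D × I` of `F × I`. -/
def DI : Set (F × unitInterval) := D ×ˢ univ

/-- The auxiliary choices that enter the construction of the self-insertion of the plug at `σ`:
an attaching map and an extension of `σ` to `D × I`. -/
structure SelfInsertion where
  /-- an open neighbourhood of the boundary of `F × I` -/
  N : Set (F × unitInterval)
  isOpen_N : IsOpen N
  boundary_subset_N : boundaryFI ⊆ N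
  /-- the attaching map, only used on `N`: a homeomorphism from `N` to a neighbourhood of the boundary
  of the plug, which preserves leaves and extends `α₋` and `α₊` -/
  attach : F × unitInterval → W
  isOpenEmbedding_attach : IsOpenEmbedding (N.domRestrict attach)
  boundary_subset_attach : boundaryW ⊆ attach '' N
  attach_leaf : ∀ p : F, @Continuous {t : unitInterval // (p, t) ∈ N} W inferInstance leafTopology
    (fun t => attach (p, t.1))
  attach_zero : ∀ p : F, attach (p, 0) = bottom p
  attach_one : ∀ p : F, attach (p, 1) = top p
  /-- the extension of `σ`, only used on `D × I`: an embedding which sends each fibre `{p} × I` into a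
  leaf, compatibly with orientations, and which avoids the top and the bottom of the plug -/
  thick : F × unitInterval → W
  isEmbedding_thick : IsEmbedding (DI.domRestrict thick)
  thick_zero : ∀ p ∈ D, thick (p, 0) = sigma p
  thick_leaf : ∀ p ∈ D, ∃ (b : ℝ) (γ : ℝ → W) (u : unitInterval → ℝ), IsTrajectory 0 b γ ∧
    Continuous u ∧ StrictMono u ∧ ∀ t, u t ∈ Icc 0 b ∧ thick (p, t) = γ (u t)
  thick_avoids : ∀ x ∈ DI, thick x ∉ range bottom ∪ range top
  disjoint_thick_attach : Disjoint (thick '' DI) (closure (attach '' (DI ∩ N)))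

namespace SelfInsertion

variable (S : SelfInsertion)

/-- What remains of the plug when `σ ((D × I) - N)` is removed. -/
def Rest : Type := {w : W // w ∉ S.thick '' (DI \ S.N)}

/-- The gluing: `σ x` is identified with `α x` for `x` in `(D × I) ∩ N`. -/
def Glue (v w : S.Rest) : Prop := ∃ x ∈ DI ∩ S.N, v.1 = S.thick x ∧ w.1 = S.attach x

/-- The space obtained by gluing the rest of the plug to itself (the quotient by the equivalence
relation generated by the gluing). -/
def Hat : Type := Quot S.Glue

/-- The leaf topology of the self-inserted foliation: the quotient of the leaf topology on the rest
of the plug. -/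
@[reducible] def hatLeafTopology : TopologicalSpace S.Hat :=
  TopologicalSpace.coinduced (Quot.mk S.Glue)
    (TopologicalSpace.induced (fun w : S.Rest => (w.1 : W)) leafTopology)

/-- A part `Y` of the self-inserted space with the leaf topology of the restricted foliation. -/
def Part (Y : Set S.Hat) : Type := Y

instance (Y : Set S.Hat) : TopologicalSpace (S.Part Y) :=
  TopologicalSpace.induced (fun y : Y => (y : S.Hat)) S.hatLeafTopology

/-- The leaves of the foliation restricted to `Y`: the components of `Y` in the leaf topology. -/
def IsLeaf (Y : Set S.Hat) (L : Set (S.Part Y)) : Prop :=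
  ∃ x : S.Part Y, L = connectedComponent x

/-- A leaf is circular if it is, in the leaf topology, homeomorphic to a circle. -/
def IsCircularLeaf (Y : Set S.Hat) (L : Set (S.Part Y)) : Prop :=
  S.IsLeaf Y L ∧ Nonempty (L ≃ₜ Circle)

end SelfInsertion

end

end AnalyticPlug

/-!
# The self-inserted plug has no circular leaves

In the plug `W` a leaf is determined by its radius, by a phase (the angle minus the angle turned on
the way to the given height) and, for radius `0`, by its position relative to the two circular
leaves. Since the upper copy unwinds the turning of the lower one, a leaf of nonzero radius joins a
bottom point to the top point above it (`leafLabel_top`). Except for the two circles, leaves are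
ordered by height; each circle passes through a value of `σ`, and can be cut open there (`position`).

Self-insertion replaces the fibre `σ ({p} × I)` by the leaf from `bottom p` to `top p` (for radius `0`,
by two half-infinite leaves). So every leaf of `W` is inserted into at most one other leaf, at a place
that it determines (`InsertedAt`). The radius does not increase from a leaf to the one it is inserted
into, and it stays the same only when that one is a circle, which is not inserted anywhere. Thus the
leaves form a forest, and points can be compared on the first common leaf that they are inserted into,
directly or indirectly: this is the relation `After`, which is asymmetric (`after_asymm`).

As a set, the self-inserted plug is the complement of all inserted fibres (`toPlug`), and
`isOpen_preimage_toPlug` describes enough of its leaf topology: a trajectory that enters a fibre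
`σ ({p} × I)` continues from `bottom p`, and one that leaves it comes from `top p`. It follows that the
points after a given point `x`, and the points other than `x` that are not after it, form open sets
(`isOpen_after`), while the points near `x` are comparable to `x` (`isOpen_spine_leaves`).

On a simple closed curve, each point `c` has connected complement, so that either all or none of the
other points are after `c`. As at most one point can precede all others, and yet nearby points are
comparable, this is absurd (`not_injective_circle`).
-/

namespace AnalyticPlug

noncomputable section

open Set Topology

/-! ### Coordinates on the plug and the flow of heights -/

/-- The radial coordinate `r`. -/
def radius (w : W) : ℝ := w.1.1

/-- The height coordinate, running from `-1` to `3`; both circular leaves have radius `0`, and their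
heights are `0` and `2`. -/
def height (w : W) : ℝ := w.2

/-- The reflection `h ↦ 2 - h` exchanges the two copies. Folding along it turns the height into the
coordinate `z` of the lower copy and `-z` of the upper one. -/
def fold (h : ℝ) : ℝ := min h (2 - h)

/-- The vertical speed of trajectories. -/
def speed (r h : ℝ) : ℝ := r ^ 2 + fold h ^ 6

lemma fold_of_le {h : ℝ} (hh : h ≤ 1) : fold h = h := min_eq_left (by linarith)

lemma fold_of_ge {h : ℝ} (hh : 1 ≤ h) : fold h = 2 - h := min_eq_right (by linarith)

lemma fold_mem {h : ℝ} (hh : h ∈ Icc (-1 : ℝ) 3) : fold h ∈ Icc (-1 : ℝ) 1 := by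
  rcases le_total h 1 with h1 | h1
  · rw [fold_of_le h1]; exact ⟨hh.1, h1⟩
  · rw [fold_of_ge h1]; exact ⟨by linarith [hh.2], by linarith⟩

lemma fold_eq_zero {h : ℝ} : fold h = 0 ↔ h = 0 ∨ h = 2 := by
  rcases le_total h 1 with h1 | h1
  · rw [fold_of_le h1]
    exact ⟨Or.inl, fun h' => h'.elim id fun h' => by linarith⟩
  · rw [fold_of_ge h1]
    exact ⟨fun h' => Or.inr (by linarith), fun h' => h'.elim (fun h' => by linarith)
      fun h' => by linarith⟩

lemma radius_point {r θ h : ℝ} (hr : r ∈ Icc (-1 : ℝ) 1) : radius (point r θ h) = r := by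
  simp [radius, point, projIcc_of_mem _ hr]

lemma height_point {r θ h : ℝ} (hh : h ∈ Icc (-1 : ℝ) 3) : height (point r θ h) = h := by
  simp [height, point, projIcc_of_mem _ hh]

lemma height_mem (w : W) : height w ∈ Icc (-1 : ℝ) 3 := w.2.2

lemma W_ext {v w : W} (hr : radius v = radius w) (ha : v.1.2 = w.1.2)
    (hh : height v = height w) : v = w :=
  Prod.ext (Prod.ext (Subtype.ext hr) ha) (Subtype.ext hh)

lemma hasDerivWithinAt_Icc_of_split {f f' : ℝ → ℝ} {a b m : ℝ}
    (h₁ : ∀ t ∈ Icc a b ∩ Iic m, HasDerivWithinAt f (f' t) (Icc a b ∩ Iic m) t)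
    (h₂ : ∀ t ∈ Icc a b ∩ Ici m, HasDerivWithinAt f (f' t) (Icc a b ∩ Ici m) t) :
    ∀ t ∈ Icc a b, HasDerivWithinAt f (f' t) (Icc a b) t := by
  intro t ht
  rcases lt_trichotomy t m with h | h | h
  · exact (h₁ t ⟨ht, h.le⟩).mono_of_mem_nhdsWithin
      (Filter.inter_mem self_mem_nhdsWithin (mem_nhdsWithin_of_mem_nhds (Iic_mem_nhds h)))
  · have := (h₁ t ⟨ht, h.le⟩).union (h₂ t ⟨ht, h.ge⟩)
    rwa [← inter_union_distrib_left, Iic_union_Ici, inter_univ] at this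
  · exact (h₂ t ⟨ht, h.le⟩).mono_of_mem_nhdsWithin
      (Filter.inter_mem self_mem_nhdsWithin (mem_nhdsWithin_of_mem_nhds (Ici_mem_nhds h)))

lemma eq_of_hasDerivWithinAt_zero {f : ℝ → ℝ} {s : Set ℝ} (hs : Convex ℝ s)
    (hf : ∀ t ∈ s, HasDerivWithinAt f 0 s t) {t t' : ℝ} (ht : t ∈ s) (ht' : t' ∈ s) :
    f t = f t' := by
  have := hs.norm_image_sub_le_of_norm_hasDerivWithin_le (C := 0) hf (by simp) ht ht'
  rw [zero_mul, norm_le_zero_iff, sub_eq_zero] at this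
  exact this.symm

lemma convex_Icc_Iic (a b m : ℝ) : Convex ℝ (Icc a b ∩ Iic m) := (convex_Icc a b).inter (convex_Iic m)

lemma convex_Icc_Ici (a b m : ℝ) : Convex ℝ (Icc a b ∩ Ici m) := (convex_Icc a b).inter (convex_Ici m)

/-- A trajectory in coordinates, with the angle lifted to `ℝ` separately in the two copies. -/
lemma IsTrajectory.exists_lifts {a b : ℝ} {γ : ℝ → W} (hγ : IsTrajectory a b γ) :
    ∃ (m : ℝ) (θ₁ θ₂ : ℝ → ℝ),
      (∀ t ∈ Icc a b ∩ Iic m, height (γ t) ≤ 1 ∧ (γ t).1.2 = (θ₁ t : AddCircle (10 : ℝ)) ∧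
        HasDerivWithinAt θ₁ 1 (Icc a b ∩ Iic m) t ∧
        HasDerivWithinAt (fun t => radius (γ t)) 0 (Icc a b ∩ Iic m) t ∧
        HasDerivWithinAt (fun t => height (γ t)) (speed (radius (γ t)) (height (γ t)))
          (Icc a b ∩ Iic m) t) ∧
      (∀ t ∈ Icc a b ∩ Ici m, 1 ≤ height (γ t) ∧ (γ t).1.2 = (θ₂ t : AddCircle (10 : ℝ)) ∧
        HasDerivWithinAt θ₂ (-1) (Icc a b ∩ Ici m) t ∧
        HasDerivWithinAt (fun t => radius (γ t)) 0 (Icc a b ∩ Ici m) t ∧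
        HasDerivWithinAt (fun t => height (γ t)) (speed (radius (γ t)) (height (γ t)))
          (Icc a b ∩ Ici m) t) := by
  obtain ⟨m, c₁, c₂, h₁, h₂⟩ := hγ
  refine ⟨m, fun t => (c₁ t).2.1, fun t => (c₂ t).2.1, fun t ht => ?_, fun t ht => ?_⟩
  · have hr : ∀ s ∈ Icc a b ∩ Iic m, radius (γ s) = (c₁ s).1 := fun s hs => by
      rw [(h₁ s hs).2.1]; exact radius_point (h₁ s hs).1.1
    have hh : ∀ s ∈ Icc a b ∩ Iic m, height (γ s) = (c₁ s).2.2 := fun s hs => by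
      rw [(h₁ s hs).2.1]
      exact height_point ⟨(h₁ s hs).1.2.1, by linarith [(h₁ s hs).1.2.2]⟩
    obtain ⟨hb, he, hd⟩ := h₁ t ht
    have hd1 := hd.hasFDerivWithinAt.fst.hasDerivWithinAt
    have hd2 := hd.hasFDerivWithinAt.snd.fst.hasDerivWithinAt
    have hd3 := hd.hasFDerivWithinAt.snd.snd.hasDerivWithinAt
    simp only [lowerField, ContinuousLinearMap.coe_comp, ContinuousLinearMap.coe_fst',
      ContinuousLinearMap.coe_snd', Function.comp_apply,
      ContinuousLinearMap.toSpanSingleton_apply, one_smul] at hd1 hd2 hd3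
    have hle : height (γ t) ≤ 1 := by rw [hh t ht]; exact hb.2.2
    refine ⟨hle, by rw [he]; rfl, hd2, hd1.congr hr (hr t ht), ?_⟩
    rw [speed, fold_of_le hle, hr t ht, hh t ht]
    exact hd3.congr hh (hh t ht)
  · have hr : ∀ s ∈ Icc a b ∩ Ici m, radius (γ s) = (c₂ s).1 := fun s hs => by
      rw [(h₂ s hs).2.1]; exact radius_point (h₂ s hs).1.1
    have hh : ∀ s ∈ Icc a b ∩ Ici m, height (γ s) = (c₂ s).2.2 + 2 := fun s hs => by
      rw [(h₂ s hs).2.1]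
      exact height_point ⟨by linarith [(h₂ s hs).1.2.1], by linarith [(h₂ s hs).1.2.2]⟩
    obtain ⟨hb, he, hd⟩ := h₂ t ht
    have hd1 := hd.hasFDerivWithinAt.fst.hasDerivWithinAt
    have hd2 := hd.hasFDerivWithinAt.snd.fst.hasDerivWithinAt
    have hd3 := hd.hasFDerivWithinAt.snd.snd.hasDerivWithinAt
    simp only [upperField, ContinuousLinearMap.coe_comp, ContinuousLinearMap.coe_fst',
      ContinuousLinearMap.coe_snd', Function.comp_apply,
      ContinuousLinearMap.toSpanSingleton_apply, one_smul] at hd1 hd2 hd3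
    have hle : 1 ≤ height (γ t) := by rw [hh t ht]; linarith [hb.2.1]
    refine ⟨hle, by rw [he]; rfl, hd2, hd1.congr hr (hr t ht), ?_⟩
    rw [speed, fold_of_ge hle, hr t ht, hh t ht]
    have := (hd3.add_const 2).congr hh (hh t ht)
    rw [show (2 - ((c₂ t).2.2 + 2)) ^ 6 = (c₂ t).2.2 ^ 6 by ring]
    exact this

namespace IsTrajectory

variable {a b : ℝ} {γ : ℝ → W}

lemma radius_eq (hγ : IsTrajectory a b γ) {t t' : ℝ} (ht : t ∈ Icc a b) (ht' : t' ∈ Icc a b) :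
    radius (γ t) = radius (γ t') := by
  obtain ⟨m, θ₁, θ₂, h₁, h₂⟩ := hγ.exists_lifts
  exact eq_of_hasDerivWithinAt_zero (convex_Icc a b)
    (hasDerivWithinAt_Icc_of_split (f := fun t => radius (γ t)) (f' := fun _ => 0)
      (fun s hs => (h₁ s hs).2.2.2.1) (fun s hs => (h₂ s hs).2.2.2.1)) ht ht'

lemma hasDerivWithinAt_height (hγ : IsTrajectory a b γ) {t : ℝ} (ht : t ∈ Icc a b) :
    HasDerivWithinAt (fun t => height (γ t)) (speed (radius (γ t)) (height (γ t))) (Icc a b) t := by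
  obtain ⟨m, θ₁, θ₂, h₁, h₂⟩ := hγ.exists_lifts
  exact hasDerivWithinAt_Icc_of_split (f := fun t => height (γ t))
    (f' := fun t => speed (radius (γ t)) (height (γ t)))
      (fun s hs => (h₁ s hs).2.2.2.2) (fun s hs => (h₂ s hs).2.2.2.2) t ht

lemma continuousOn_height (hγ : IsTrajectory a b γ) :
    ContinuousOn (fun t => height (γ t)) (Icc a b) :=
  fun _ ht => (hγ.hasDerivWithinAt_height ht).continuousWithinAt

lemma continuousOn (hγ : IsTrajectory a b γ) : ContinuousOn γ (Icc a b) := by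
  have hr : ContinuousOn (fun t => (γ t).1.1) (Icc a b) := fun t ht => by
    exact (continuousWithinAt_const (b := (γ t).1.1)).congr
      (fun s hs => Subtype.ext (hγ.radius_eq hs ht)) rfl
  have hh : ContinuousOn (fun t => (γ t).2) (Icc a b) := by
    have := hγ.continuousOn_height
    rw [continuousOn_iff_continuous_domRestrict] at this ⊢
    exact continuous_induced_rng.2 this
  have hθ : ContinuousOn (fun t => (γ t).1.2) (Icc a b) := by
    obtain ⟨m, θ₁, θ₂, h₁, h₂⟩ := hγ.exists_lifts
    have e : Icc a b = (Icc a b ∩ Iic m) ∪ (Icc a b ∩ Ici m) := by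
      rw [← inter_union_distrib_left, Iic_union_Ici, inter_univ]
    rw [e]
    refine ContinuousOn.union_of_isClosed ?_ ?_ (isClosed_Icc.inter isClosed_Iic)
      (isClosed_Icc.inter isClosed_Ici)
    · refine ContinuousOn.congr (f := fun t => (θ₁ t : AddCircle (10 : ℝ))) (fun s hs => ?_)
        fun s hs => (h₁ s hs).2.1
      exact (AddCircle.continuous_mk' 10).continuousAt.comp_continuousWithinAt
        (h₁ s hs).2.2.1.continuousWithinAt
    · refine ContinuousOn.congr (f := fun t => (θ₂ t : AddCircle (10 : ℝ))) (fun s hs => ?_)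
        fun s hs => (h₂ s hs).2.1
      exact (AddCircle.continuous_mk' 10).continuousAt.comp_continuousWithinAt
        (h₂ s hs).2.2.1.continuousWithinAt
  exact (hr.prodMk hθ).prodMk hh

end IsTrajectory

lemma lipschitz_speed (r : ℝ) : LipschitzOnWith 6 (speed r) (Icc (-1) 3) := by
  have hp : LipschitzOnWith 6 (fun x : ℝ => r ^ 2 + x ^ 6) (Icc (-1) 1) := by
    refine (convex_Icc (-1 : ℝ) 1).lipschitzOnWith_of_nnnorm_hasDerivWithin_le
      (f' := fun x => 6 * x ^ 5) (fun x _ => ?_) (fun x hx => ?_)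
    · simpa using ((hasDerivAt_pow 6 x).const_add (r ^ 2)).hasDerivWithinAt
    · rw [← NNReal.coe_le_coe, coe_nnnorm]
      have : |x| ≤ 1 := abs_le.2 hx
      simp only [norm_mul, norm_pow, Real.norm_eq_abs]
      have := pow_le_one₀ (abs_nonneg x) this (n := 5)
      norm_num
      linarith
  have hf : LipschitzWith 1 fold := by
    have := (LipschitzWith.id (α := ℝ)).min (g := fun h => 2 - h) (Kg := 1)
      (LipschitzWith.of_dist_le_mul fun x y => by
        rw [dist_sub_left]; simp)
    rw [max_self] at this
    exact this
  have := hp.comp (hf.lipschitzOnWith (s := Icc (-1) 3)) (fun h hh => fold_mem hh)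
  rw [mul_one] at this
  exact this

/-- Heights along trajectories are determined by the radius and one value, both forward and
backward in time. -/
lemma height_unique {r a b t₀ : ℝ} {f g : ℝ → ℝ}
    (hf : ∀ t ∈ Icc a b, HasDerivWithinAt f (speed r (f t)) (Icc a b) t)
    (hg : ∀ t ∈ Icc a b, HasDerivWithinAt g (speed r (g t)) (Icc a b) t)
    (hf' : ∀ t ∈ Icc a b, f t ∈ Icc (-1 : ℝ) 3) (hg' : ∀ t ∈ Icc a b, g t ∈ Icc (-1 : ℝ) 3)
    (h₀ : t₀ ∈ Icc a b) (heq : f t₀ = g t₀) : EqOn f g (Icc a b) := by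
  have hfc : ContinuousOn f (Icc a b) := fun t ht => (hf t ht).continuousWithinAt
  have hgc : ContinuousOn g (Icc a b) := fun t ht => (hg t ht).continuousWithinAt
  have hr : EqOn f g (Icc t₀ b) := by
    have hs : Icc t₀ b ⊆ Icc a b := Icc_subset_Icc_left h₀.1
    have hn : ∀ t ∈ Ico t₀ b, Icc a b ∈ 𝓝[≥] t := fun t ht =>
      Filter.mem_of_superset (Icc_mem_nhdsGE ht.2) (Icc_subset_Icc_left (h₀.1.trans ht.1))
    exact ODE_solution_unique_of_mem_Icc_right (v := fun _ => speed r) (s := fun _ => Icc (-1) 3)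
      (fun t _ => lipschitz_speed r) (hfc.mono hs)
      (fun t ht => (hf t (hs ⟨ht.1, ht.2.le⟩)).mono_of_mem_nhdsWithin (hn t ht))
      (fun t ht => hf' t (hs ⟨ht.1, ht.2.le⟩)) (hgc.mono hs)
      (fun t ht => (hg t (hs ⟨ht.1, ht.2.le⟩)).mono_of_mem_nhdsWithin (hn t ht))
      (fun t ht => hg' t (hs ⟨ht.1, ht.2.le⟩)) heq
  have hl : EqOn f g (Icc a t₀) := by
    have hs : Icc a t₀ ⊆ Icc a b := Icc_subset_Icc_right h₀.2
    have hn : ∀ t ∈ Ioc a t₀, Icc a b ∈ 𝓝[≤] t := fun t ht =>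
      Filter.mem_of_superset (Icc_mem_nhdsLE ht.1) (Icc_subset_Icc_right (ht.2.trans h₀.2))
    exact ODE_solution_unique_of_mem_Icc_left (v := fun _ => speed r) (s := fun _ => Icc (-1) 3)
      (fun t _ => lipschitz_speed r) (hfc.mono hs)
      (fun t ht => (hf t (hs ⟨ht.1.le, ht.2⟩)).mono_of_mem_nhdsWithin (hn t ht))
      (fun t ht => hf' t (hs ⟨ht.1.le, ht.2⟩)) (hgc.mono hs)
      (fun t ht => (hg t (hs ⟨ht.1.le, ht.2⟩)).mono_of_mem_nhdsWithin (hn t ht))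
      (fun t ht => hg' t (hs ⟨ht.1.le, ht.2⟩)) heq
  intro t ht
  rcases le_total t t₀ with h | h
  · exact hl ⟨ht.1, h⟩
  · exact hr ⟨h, ht.2⟩

/-! ### Leaf labels -/

/-- The points of the two circular leaves of the plug. -/
def OnCircle (w : W) : Prop := radius w = 0 ∧ fold (height w) = 0

/-- An antiderivative in `z` of `1 / (r² + z⁶)`, the angle travelled per unit of height in the lower
copy. For `r = 0` it is defined separately on both sides of the pole `z = 0`. -/
def turn (r z : ℝ) : ℝ :=
  if r = 0 then -1 / (5 * z ^ 5) else ∫ x in (0 : ℝ)..z, (r ^ 2 + x ^ 6)⁻¹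

lemma hasDerivAt_turn {r z : ℝ} (h : r ≠ 0 ∨ z ≠ 0) :
    HasDerivAt (turn r) (r ^ 2 + z ^ 6)⁻¹ z := by
  by_cases hr : r = 0
  · have hz : z ≠ 0 := h.resolve_left (not_not.2 hr)
    subst hr
    have e : turn 0 = fun z => -1 / (5 * z ^ 5) := by
      funext z; simp [turn]
    rw [e]
    have h5 : HasDerivAt (fun z : ℝ => 5 * z ^ 5) (5 * (5 * z ^ 4)) z := by
      simpa using (hasDerivAt_pow 5 z).const_mul 5
    have := (hasDerivAt_const z (-1 : ℝ)).div h5 (by positivity)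
    have e2 : (0 * (5 * z ^ 5) - -1 * (5 * (5 * z ^ 4))) / (5 * z ^ 5) ^ 2 =
        ((0 : ℝ) ^ 2 + z ^ 6)⁻¹ := by
      rw [zero_pow two_ne_zero, zero_add]
      field_simp
      ring
    rw [← e2]
    exact this
  · have e : turn r = fun z => ∫ x in (0 : ℝ)..z, (r ^ 2 + x ^ 6)⁻¹ := by
      funext z; simp [turn, hr]
    rw [e]
    have hc : Continuous fun x : ℝ => (r ^ 2 + x ^ 6)⁻¹ :=
      Continuous.inv₀ (by fun_prop) fun x => by positivity
    exact (hc.integral_hasStrictDerivAt 0 z).hasDerivAt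

/-- The angle of `w` minus the angle that its leaf has turned up to its height. It is constant on the
leaves other than the two circles. The same formula serves both copies as the second one unwinds the
turning of the first one. -/
def phase (w : W) : AddCircle (10 : ℝ) :=
  w.1.2 - (turn (radius w) (fold (height w)) : AddCircle (10 : ℝ))

open Classical in
/-- A label that tells the leaves of the plug apart: the radius, for radius `0` the position of the
height relative to the two circles, and the phase (of no significance on the circles, so that a
constant is put there). -/
def leafLabel (w : W) : ℝ × (SignType × SignType) × AddCircle (10 : ℝ) :=
  (radius w, if radius w = 0 then (SignType.sign (height w), SignType.sign (height w - 2)) else 0,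
    if OnCircle w then 0 else phase w)

lemma radius_eq_of_leafLabel_eq {v w : W} (h : leafLabel v = leafLabel w) : radius v = radius w :=
  congrArg Prod.fst h

lemma onCircle_iff_sign {w : W} (hr : radius w = 0) :
    OnCircle w ↔ SignType.sign (height w) = 0 ∨ SignType.sign (height w - 2) = 0 := by
  rw [sign_eq_zero_iff, sign_eq_zero_iff, sub_eq_zero, ← fold_eq_zero]
  exact and_iff_right hr

lemma sign_eq_of_leafLabel_eq {v w : W} (h : leafLabel v = leafLabel w) (hr : radius w = 0) :
    SignType.sign (height v) = SignType.sign (height w) ∧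
      SignType.sign (height v - 2) = SignType.sign (height w - 2) := by
  have h2 := congrArg (fun l => l.2.1) h
  simp only [leafLabel, radius_eq_of_leafLabel_eq h, hr, if_true] at h2
  exact Prod.mk.inj h2

lemma onCircle_iff_of_leafLabel_eq {v w : W} (h : leafLabel v = leafLabel w) :
    OnCircle v ↔ OnCircle w := by
  have hr := radius_eq_of_leafLabel_eq h
  by_cases h0 : radius w = 0
  · obtain ⟨h1, h2⟩ := sign_eq_of_leafLabel_eq h h0
    rw [onCircle_iff_sign h0, onCircle_iff_sign (hr.trans h0), h1, h2]
  · exact ⟨fun hv => absurd (hr.symm.trans hv.1) h0, fun hw => absurd hw.1 h0⟩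

lemma phase_eq_of_leafLabel_eq {v w : W} (h : leafLabel v = leafLabel w) (hw : ¬ OnCircle w) :
    phase v = phase w := by
  have h2 := congrArg (fun l => l.2.2) h
  simpa only [leafLabel, hw, (onCircle_iff_of_leafLabel_eq h).not.2 hw, if_false] using h2

lemma leafLabel_eq {v w : W} (hr : radius v = radius w)
    (hs : radius w = 0 → SignType.sign (height v) = SignType.sign (height w) ∧
      SignType.sign (height v - 2) = SignType.sign (height w - 2))
    (hp : ¬ OnCircle w → phase v = phase w) : leafLabel v = leafLabel w := by
  have hc : OnCircle v ↔ OnCircle w := by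
    by_cases h0 : radius w = 0
    · rw [onCircle_iff_sign h0, onCircle_iff_sign (hr.trans h0), (hs h0).1, (hs h0).2]
    · exact ⟨fun hv => absurd (hr.symm.trans hv.1) h0, fun hw => absurd hw.1 h0⟩
  refine Prod.ext hr (Prod.ext ?_ ?_)
  · by_cases h0 : radius w = 0
    · simp [leafLabel, hr, h0, (hs h0).1, (hs h0).2]
    · simp [leafLabel, hr, h0]
  · by_cases hw : OnCircle w
    · simp [leafLabel, hw, hc]
    · simp [leafLabel, hw, hc, hp hw]

namespace IsTrajectory

variable {a b : ℝ} {γ : ℝ → W}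

/-- Only trajectories on a circular leaf ever have height `0` or `2` at radius `0`. -/
lemma height_eq_of_onCircle (hγ : IsTrajectory a b γ) {t t' : ℝ} (ht : t ∈ Icc a b)
    (ht' : t' ∈ Icc a b) (hc : OnCircle (γ t)) : height (γ t') = height (γ t) := by
  refine height_unique (r := 0) (f := fun t => height (γ t)) (g := fun _ => height (γ t))
    (fun s hs => ?_) (fun s _ => ?_) (fun s _ => height_mem _) (fun s _ => height_mem _) ht rfl ht'
  · have := hγ.hasDerivWithinAt_height hs
    rwa [hγ.radius_eq hs ht, hc.1] at this
  · have : speed 0 (height (γ t)) = 0 := by simp [speed, hc.2]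
    rw [this]
    exact hasDerivWithinAt_const _ _ _

lemma onCircle (hγ : IsTrajectory a b γ) {t t' : ℝ} (ht : t ∈ Icc a b)
    (ht' : t' ∈ Icc a b) (hc : OnCircle (γ t)) : OnCircle (γ t') :=
  ⟨(hγ.radius_eq ht' ht).trans hc.1, by rw [hγ.height_eq_of_onCircle ht ht' hc]; exact hc.2⟩

lemma sign_eq (hγ : IsTrajectory a b γ) {c t t' : ℝ} (ht : t ∈ Icc a b) (ht' : t' ∈ Icc a b)
    (hc : ∀ s ∈ Icc a b, height (γ s) ≠ c) :
    SignType.sign (height (γ t) - c) = SignType.sign (height (γ t') - c) := by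
  refine isPreconnected_Icc.constant (f := fun t => SignType.sign (height (γ t) - c))
    (fun s hs => ?_) ht ht'
  exact ContinuousAt.comp_continuousWithinAt (f := fun t => height (γ t) - c)
    (continuousAt_sign_of_ne_zero (sub_ne_zero.2 (hc s hs)))
    ((hγ.continuousOn_height s hs).sub continuousWithinAt_const)

lemma phase_eq (hγ : IsTrajectory a b γ) {t t' : ℝ} (ht : t ∈ Icc a b) (ht' : t' ∈ Icc a b)
    (hc : ¬ OnCircle (γ t)) : phase (γ t) = phase (γ t') := by
  have hc' : ∀ s ∈ Icc a b, radius (γ t) ≠ 0 ∨ fold (height (γ s)) ≠ 0 := fun s hs => by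
    by_contra! h
    exact hc (hγ.onCircle hs ht ⟨(hγ.radius_eq hs ht).trans h.1, h.2⟩)
  have hne : ∀ {z : ℝ}, radius (γ t) ≠ 0 ∨ z ≠ 0 → radius (γ t) ^ 2 + z ^ 6 ≠ 0 := by
    intro z hz
    rcases hz with hz | hz
    · positivity
    · positivity
  obtain ⟨m, θ₁, θ₂, h₁, h₂⟩ := hγ.exists_lifts
  have k₁ : ∀ s ∈ Icc a b ∩ Iic m, ∀ s' ∈ Icc a b ∩ Iic m, phase (γ s) = phase (γ s') := by
    have hd : ∀ s ∈ Icc a b ∩ Iic m, HasDerivWithinAt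
        (fun s => θ₁ s - turn (radius (γ t)) (height (γ s))) 0 (Icc a b ∩ Iic m) s := by
      intro s hs
      obtain ⟨hl, -, hθ, -, hh⟩ := h₁ s hs
      have hz := hc' s hs.1
      rw [fold_of_le hl] at hz
      have := hθ.sub ((hasDerivAt_turn hz).comp_hasDerivWithinAt s hh)
      rw [speed, fold_of_le hl, hγ.radius_eq hs.1 ht, inv_mul_cancel₀ (hne hz), sub_self] at this
      exact this
    have e : ∀ s ∈ Icc a b ∩ Iic m, phase (γ s) =
        ((θ₁ s - turn (radius (γ t)) (height (γ s)) : ℝ) : AddCircle (10 : ℝ)) := fun s hs => by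
      rw [phase, fold_of_le (h₁ s hs).1, hγ.radius_eq hs.1 ht, (h₁ s hs).2.1, AddCircle.coe_sub]
    intro s hs s' hs'
    rw [e s hs, e s' hs', eq_of_hasDerivWithinAt_zero (convex_Icc_Iic a b m) hd hs hs']
  have k₂ : ∀ s ∈ Icc a b ∩ Ici m, ∀ s' ∈ Icc a b ∩ Ici m, phase (γ s) = phase (γ s') := by
    have hd : ∀ s ∈ Icc a b ∩ Ici m, HasDerivWithinAt
        (fun s => θ₂ s - turn (radius (γ t)) (2 - height (γ s))) 0 (Icc a b ∩ Ici m) s := by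
      intro s hs
      obtain ⟨hl, -, hθ, -, hh⟩ := h₂ s hs
      have hz := hc' s hs.1
      rw [fold_of_ge hl] at hz
      have := hθ.sub ((hasDerivAt_turn hz).comp_hasDerivWithinAt s (hh.const_sub 2))
      rw [speed, fold_of_ge hl, hγ.radius_eq hs.1 ht, mul_neg, inv_mul_cancel₀ (hne hz),
        sub_self] at this
      exact this
    have e : ∀ s ∈ Icc a b ∩ Ici m, phase (γ s) =
        ((θ₂ s - turn (radius (γ t)) (2 - height (γ s)) : ℝ) : AddCircle (10 : ℝ)) :=
      fun s hs => by
        rw [phase, fold_of_ge (h₂ s hs).1, hγ.radius_eq hs.1 ht, (h₂ s hs).2.1, AddCircle.coe_sub]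
    intro s hs s' hs'
    rw [e s hs, e s' hs', eq_of_hasDerivWithinAt_zero (convex_Icc_Ici a b m) hd hs hs']
  rcases le_total t m with h | h <;> rcases le_total t' m with h' | h'
  · exact k₁ t ⟨ht, h⟩ t' ⟨ht', h'⟩
  · have hm : m ∈ Icc a b := ⟨ht.1.trans h, h'.trans ht'.2⟩
    exact (k₁ t ⟨ht, h⟩ m ⟨hm, mem_Iic.2 le_rfl⟩).trans (k₂ m ⟨hm, mem_Ici.2 le_rfl⟩ t' ⟨ht', h'⟩)
  · have hm : m ∈ Icc a b := ⟨ht'.1.trans h', h.trans ht.2⟩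
    exact (k₂ t ⟨ht, h⟩ m ⟨hm, mem_Ici.2 le_rfl⟩).trans (k₁ m ⟨hm, mem_Iic.2 le_rfl⟩ t' ⟨ht', h'⟩)
  · exact k₂ t ⟨ht, h⟩ t' ⟨ht', h'⟩

/-- Leaf labels are constant along trajectories. -/
lemma leafLabel_eq (hγ : IsTrajectory a b γ) {t t' : ℝ} (ht : t ∈ Icc a b) (ht' : t' ∈ Icc a b) :
    leafLabel (γ t) = leafLabel (γ t') := by
  refine AnalyticPlug.leafLabel_eq (hγ.radius_eq ht ht') (fun h0 => ?_)
    fun hc => (hγ.phase_eq ht' ht hc).symm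
  by_cases hc : OnCircle (γ t')
  · simp [hγ.height_eq_of_onCircle ht' ht hc]
  · have hne : ∀ s ∈ Icc a b, fold (height (γ s)) ≠ 0 := fun s hs h =>
      hc (hγ.onCircle hs ht' ⟨(hγ.radius_eq hs ht').trans h0, h⟩)
    refine ⟨?_, hγ.sign_eq ht ht' fun s hs h => hne s hs (fold_eq_zero.2 (Or.inr h))⟩
    simpa using hγ.sign_eq (c := 0) ht ht' fun s hs h => hne s hs (fold_eq_zero.2 (Or.inl h))

lemma strictMonoOn_height (hγ : IsTrajectory a b γ) {t : ℝ} (ht : t ∈ Icc a b)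
    (hc : ¬ OnCircle (γ t)) : StrictMonoOn (fun t => height (γ t)) (Icc a b) := by
  refine strictMonoOn_of_hasDerivWithinAt_pos (convex_Icc a b) hγ.continuousOn_height
    (f' := fun t => speed (radius (γ t)) (height (γ t)))
    (fun s hs => (hγ.hasDerivWithinAt_height (interior_subset hs)).mono interior_subset)
    fun s hs => ?_
  have hs' := interior_subset hs
  have : radius (γ s) ≠ 0 ∨ fold (height (γ s)) ≠ 0 := by
    by_contra! h
    exact hc (hγ.onCircle hs' ht h)
  rw [speed]
  rcases this with h | h <;> positivity

/-- Motion on the circular leaves. -/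
lemma angle_eq_of_onCircle (hγ : IsTrajectory a b γ) {t t' : ℝ} (ht : t ∈ Icc a b)
    (ht' : t' ∈ Icc a b) (hc : OnCircle (γ t)) :
    (γ t').1.2 = (γ t).1.2 +
      ((if height (γ t) = 0 then t' - t else -(t' - t) : ℝ) : AddCircle (10 : ℝ)) := by
  obtain ⟨m, θ₁, θ₂, h₁, h₂⟩ := hγ.exists_lifts
  have hH := fun s hs => hγ.height_eq_of_onCircle (t' := s) ht hs hc
  rcases fold_eq_zero.1 hc.2 with h | h
  · have hI : ∀ s ∈ Icc a b, s ∈ Icc a b ∩ Iic m := fun s hs => by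
      refine ⟨hs, ?_⟩
      by_contra hlt
      have := (h₂ s ⟨hs, mem_Ici.2 (not_le.1 hlt).le⟩).1
      rw [hH s hs, h] at this
      linarith
    rw [if_pos h]
    have := eq_of_hasDerivWithinAt_zero (convex_Icc_Iic a b m) (f := fun s => θ₁ s - s)
      (fun s hs => by simpa using! (h₁ s hs).2.2.1.sub (hasDerivWithinAt_id s _)) (hI t ht)
      (hI t' ht')
    rw [(h₁ t (hI t ht)).2.1, (h₁ t' (hI t' ht')).2.1, ← AddCircle.coe_add]
    congr 1
    linarith
  · have hI : ∀ s ∈ Icc a b, s ∈ Icc a b ∩ Ici m := fun s hs => by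
      refine ⟨hs, ?_⟩
      by_contra hlt
      have := (h₁ s ⟨hs, mem_Iic.2 (not_le.1 hlt).le⟩).1
      rw [hH s hs, h] at this
      linarith
    rw [if_neg (by rw [h]; norm_num)]
    have := eq_of_hasDerivWithinAt_zero (convex_Icc_Ici a b m) (f := fun s => θ₂ s + s)
      (fun s hs => by simpa using! (h₂ s hs).2.2.1.add (hasDerivWithinAt_id s _)) (hI t ht)
      (hI t' ht')
    rw [(h₂ t (hI t ht)).2.1, (h₂ t' (hI t' ht')).2.1, ← AddCircle.coe_add]
    congr 1
    linarith

/-- Trajectories that pass through the same point agree, after a shift of time, as long as both are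
defined. -/
lemma unique (hγ : IsTrajectory a b γ) {a' b' : ℝ} {γ' : ℝ → W} (hγ' : IsTrajectory a' b' γ')
    {t t' δ : ℝ} (ht : t ∈ Icc a b) (ht' : t' ∈ Icc a' b') (he : γ t = γ' t')
    (hd : t + δ ∈ Icc a b) (hd' : t' + δ ∈ Icc a' b') : γ (t + δ) = γ' (t' + δ) := by
  have hr : radius (γ (t + δ)) = radius (γ' (t' + δ)) := by
    rw [hγ.radius_eq hd ht, hγ'.radius_eq hd' ht', he]
  have hh : height (γ (t + δ)) = height (γ' (t' + δ)) := by
    let A := max (a - t) (a' - t')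
    let B := min (b - t) (b' - t')
    have hA : ∀ s ∈ Icc A B, t + s ∈ Icc a b := fun s hs =>
      ⟨by linarith [(le_max_left _ _).trans hs.1], by linarith [hs.2.trans (min_le_left _ _)]⟩
    have hA' : ∀ s ∈ Icc A B, t' + s ∈ Icc a' b' := fun s hs =>
      ⟨by linarith [(le_max_right _ _).trans hs.1], by linarith [hs.2.trans (min_le_right _ _)]⟩
    have key : ∀ {a b : ℝ} {γ : ℝ → W} (_ : IsTrajectory a b γ) {t : ℝ} (_ : t ∈ Icc a b),
        (∀ s ∈ Icc A B, t + s ∈ Icc a b) → ∀ s ∈ Icc A B,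
        HasDerivWithinAt (fun s => height (γ (t + s)))
          (speed (radius (γ t)) (height (γ (t + s)))) (Icc A B) s := by
      intro a b γ hγ t ht hm s hs
      have h := hγ.hasDerivWithinAt_height (hm s hs)
      rw [hγ.radius_eq (hm s hs) ht] at h
      have := h.scomp s (((hasDerivAt_id s).const_add t).hasDerivWithinAt (s := Icc A B)) hm
      simpa using! this
    have := height_unique (r := radius (γ t)) (t₀ := 0) (key hγ ht hA)
      (by rw [he]; exact key hγ' ht' hA') (fun s _ => height_mem _) (fun s _ => height_mem _)
      ⟨max_le (by linarith [ht.1]) (by linarith [ht'.1]),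
        le_min (by linarith [ht.2]) (by linarith [ht'.2])⟩ (by simp [he])
    exact this ⟨max_le (by linarith [hd.1]) (by linarith [hd'.1]),
      le_min (by linarith [hd.2]) (by linarith [hd'.2])⟩
  refine W_ext hr ?_ hh
  by_cases hc : OnCircle (γ t)
  · rw [hγ.angle_eq_of_onCircle ht hd hc, hγ'.angle_eq_of_onCircle ht' hd' (he ▸ hc), he]
    simp
  · have := (hγ.phase_eq ht hd hc).symm.trans
      ((congrArg phase he).trans (hγ'.phase_eq ht' hd' (he ▸ hc)))
    simpa only [phase, hr, hh, sub_left_inj] using this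

end IsTrajectory

/-! ### Positions on a leaf -/

open Classical in
/-- The position on a leaf, increasing along trajectories: the height, except on the two circles,
where it is the angle with the orientation of the leaf. The circles are cut open at the points
`(0, 6, 0)` of the lower copy and `(0, 4, 0)` of the upper copy, which are values of the
self-insertion map; the cut point itself is given the last position on the circle. -/
def position (w : W) : ℝ :=
  if OnCircle w then
    if height w = 0 then AddCircle.equivIoc 10 6 w.1.2 else AddCircle.equivIoc 10 (-4) (-w.1.2)
  else height w

/-- The points where the circular leaves are cut open. -/
def IsCut (w : W) : Prop := w = point 0 6 0 ∨ w = point 0 4 2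

lemma position_of_not_onCircle {w : W} (h : ¬ OnCircle w) : position w = height w := if_neg h

lemma equivIoc_coe {c x : ℝ} (hx : x ∈ Ioc c (c + 10)) :
    (AddCircle.equivIoc 10 c (x : AddCircle (10 : ℝ)) : ℝ) = x := by
  have := (AddCircle.equivIoc (10 : ℝ) c).apply_symm_apply ⟨x, hx⟩
  exact congrArg Subtype.val this

lemma eq_of_position_eq {v w : W} (hl : leafLabel v = leafLabel w)
    (hp : position v = position w) : v = w := by
  have hr := radius_eq_of_leafLabel_eq hl
  have hc := onCircle_iff_of_leafLabel_eq hl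
  by_cases h : OnCircle w
  · have hs := (sign_eq_of_leafLabel_eq hl h.1).1
    have hv := hc.2 h
    rcases fold_eq_zero.1 h.2 with h0 | h2
    · have hv0 : height v = 0 := by rwa [h0, sign_zero, sign_eq_zero_iff] at hs
      rw [position, position, if_pos h, if_pos hv, if_pos h0, if_pos hv0] at hp
      exact W_ext hr ((AddCircle.equivIoc (10 : ℝ) 6).injective (Subtype.ext hp)) (hv0.trans h0.symm)
    · have hw0 : height w ≠ 0 := by rw [h2]; norm_num
      have hv0 : height v ≠ 0 := fun h0 => hw0 (by rwa [h0, sign_zero, eq_comm,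
        sign_eq_zero_iff] at hs)
      have hv2 : height v = 2 := (fold_eq_zero.1 hv.2).resolve_left hv0
      rw [position, position, if_pos h, if_pos hv, if_neg hw0, if_neg hv0] at hp
      exact W_ext hr (neg_injective ((AddCircle.equivIoc (10 : ℝ) (-4)).injective
        (Subtype.ext hp))) (hv2.trans h2.symm)
  · rw [position_of_not_onCircle h, position_of_not_onCircle (hc.not.2 h)] at hp
    have hph := phase_eq_of_leafLabel_eq hl h
    exact W_ext hr (by simpa only [phase, hr, hp, sub_left_inj] using hph) hp

namespace IsTrajectory

variable {a b : ℝ} {γ : ℝ → W}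

/-- On the circles, the position is the time, up to a constant, for as long as the cut point is not
passed. -/
lemma position_eq_of_onCircle (hγ : IsTrajectory a b γ) {t : ℝ} (ht : t ∈ Icc a b)
    (hc : OnCircle (γ t)) :
    ∃ c, position (γ t) ∈ Ioc c (c + 10) ∧ (position (γ t) = c + 10 → IsCut (γ t)) ∧
      ∀ t' ∈ Icc a b, position (γ t) + (t' - t) ∈ Ioc c (c + 10) →
        position (γ t') = position (γ t) + (t' - t) := by
  have hr := hc.1
  rcases fold_eq_zero.1 hc.2 with h | h
  · have hp : position (γ t) = AddCircle.equivIoc 10 6 (γ t).1.2 := by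
      rw [position, if_pos hc, if_pos h]
    have hcoe : ((position (γ t) : ℝ) : AddCircle (10 : ℝ)) = (γ t).1.2 := by
      rw [hp]; exact AddCircle.coe_equivIoc
    refine ⟨6, hp ▸ (AddCircle.equivIoc 10 6 (γ t).1.2).2, fun h16 => Or.inl ?_, fun t' ht' hI => ?_⟩
    · refine W_ext ?_ ?_ ?_
      · rw [radius_point (by norm_num), hr]
      · rw [← hcoe, h16, AddCircle.coe_add, AddCircle.coe_period, add_zero]; rfl
      · rw [height_point (by norm_num), h]
    · have hH := hγ.height_eq_of_onCircle ht ht' hc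
      rw [position, if_pos (hγ.onCircle ht ht' hc), if_pos (hH.trans h),
        hγ.angle_eq_of_onCircle ht ht' hc, if_pos h, ← hcoe, ← AddCircle.coe_add, equivIoc_coe hI]
  · have h0 : height (γ t) ≠ 0 := by rw [h]; norm_num
    have hp : position (γ t) = AddCircle.equivIoc 10 (-4) (-(γ t).1.2) := by
      rw [position, if_pos hc, if_neg h0]
    have hcoe : ((position (γ t) : ℝ) : AddCircle (10 : ℝ)) = -(γ t).1.2 := by
      rw [hp]; exact AddCircle.coe_equivIoc
    refine ⟨-4, hp ▸ (AddCircle.equivIoc 10 (-4) (-(γ t).1.2)).2, fun h16 => Or.inr ?_,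
      fun t' ht' hI => ?_⟩
    · refine W_ext ?_ ?_ ?_
      · rw [radius_point (by norm_num), hr]
      · rw [← neg_neg (γ t).1.2, ← hcoe, h16, AddCircle.coe_add, AddCircle.coe_period, add_zero,
          ← AddCircle.coe_neg, neg_neg]; rfl
      · rw [height_point (by norm_num), h]
    · have hH := hγ.height_eq_of_onCircle ht ht' hc
      rw [position, if_pos (hγ.onCircle ht ht' hc), if_neg (hH.trans_ne h0),
        hγ.angle_eq_of_onCircle ht ht' hc, if_neg h0, neg_add, ← hcoe, ← AddCircle.coe_neg, neg_neg,
        ← AddCircle.coe_add, equivIoc_coe hI]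

lemma eventually_position_left (hγ : IsTrajectory a b γ) {t : ℝ} (ht : t ∈ Icc a b) (c : ℝ) :
    ∀ᶠ t' in 𝓝[Icc a b ∩ Iio t] t, position (γ t') < position (γ t) ∧
      (c < position (γ t) → c < position (γ t')) := by
  by_cases hc : OnCircle (γ t)
  · obtain ⟨d, hd, -, hp⟩ := hγ.position_eq_of_onCircle ht hc
    have h1 : ∀ᶠ t' in 𝓝 t, d < position (γ t) + (t' - t) :=
      (by fun_prop : Continuous fun t' : ℝ => position (γ t) + (t' - t)).continuousAt.eventually_const_lt
        (by simpa using hd.1)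
    have h2 : ∀ᶠ t' in 𝓝 t, c < position (γ t) → c < position (γ t) + (t' - t) := by
      by_cases hcp : c < position (γ t)
      · filter_upwards [(by fun_prop : Continuous fun t' : ℝ =>
          position (γ t) + (t' - t)).continuousAt.eventually_const_lt (by simpa using hcp)] with s hs _
        using hs
      · exact Filter.Eventually.of_forall fun _ h => absurd h hcp
    filter_upwards [mem_nhdsWithin_of_mem_nhds h1, mem_nhdsWithin_of_mem_nhds h2,
      self_mem_nhdsWithin] with t' h1 h2 h3
    have h3' : t' < t := h3.2
    have := hp t' h3.1 ⟨h1, by linarith [hd.2]⟩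
    rw [this]
    exact ⟨by linarith, h2⟩
  · have hm := hγ.strictMonoOn_height ht hc
    have h2 : ∀ᶠ t' in 𝓝[Icc a b] t, c < height (γ t) → c < height (γ t') := by
      by_cases hcp : c < height (γ t)
      · filter_upwards [(hγ.continuousOn_height t ht).eventually_const_lt hcp] with s hs _ using hs
      · exact Filter.Eventually.of_forall fun _ h => absurd h hcp
    filter_upwards [nhdsWithin_mono t inter_subset_left h2, self_mem_nhdsWithin] with t' h2 h3
    rw [position_of_not_onCircle hc,
      position_of_not_onCircle fun h => hc (hγ.onCircle h3.1 ht h)]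
    exact ⟨hm h3.1 ht h3.2, h2⟩

lemma eventually_position_right (hγ : IsTrajectory a b γ) {t : ℝ} (ht : t ∈ Icc a b)
    (hcut : ¬ IsCut (γ t)) (c : ℝ) :
    ∀ᶠ t' in 𝓝[Icc a b ∩ Ioi t] t, position (γ t) < position (γ t') ∧
      (position (γ t) < c → position (γ t') < c) := by
  by_cases hc : OnCircle (γ t)
  · obtain ⟨d, hd, hd', hp⟩ := hγ.position_eq_of_onCircle ht hc
    have hlt : position (γ t) < d + 10 := lt_of_le_of_ne hd.2 fun h => hcut (hd' h)
    have h1 : ∀ᶠ t' in 𝓝 t, position (γ t) + (t' - t) < d + 10 :=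
      (by fun_prop : Continuous fun t' : ℝ => position (γ t) + (t' - t)).continuousAt.eventually_lt_const
        (by simpa using hlt)
    have h2 : ∀ᶠ t' in 𝓝 t, position (γ t) < c → position (γ t) + (t' - t) < c := by
      by_cases hcp : position (γ t) < c
      · filter_upwards [(by fun_prop : Continuous fun t' : ℝ =>
          position (γ t) + (t' - t)).continuousAt.eventually_lt_const (by simpa using hcp)] with s hs _
        using hs
      · exact Filter.Eventually.of_forall fun _ h => absurd h hcp
    filter_upwards [mem_nhdsWithin_of_mem_nhds h1, mem_nhdsWithin_of_mem_nhds h2,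
      self_mem_nhdsWithin] with t' h1 h2 h3
    have h3' : t < t' := h3.2
    have := hp t' h3.1 ⟨by linarith [hd.1], h1.le⟩
    rw [this]
    exact ⟨by linarith, h2⟩
  · have hm := hγ.strictMonoOn_height ht hc
    have h2 : ∀ᶠ t' in 𝓝[Icc a b] t, height (γ t) < c → height (γ t') < c := by
      by_cases hcp : height (γ t) < c
      · filter_upwards [(hγ.continuousOn_height t ht).eventually_lt_const hcp] with s hs _ using hs
      · exact Filter.Eventually.of_forall fun _ h => absurd h hcp
    filter_upwards [nhdsWithin_mono t inter_subset_left h2, self_mem_nhdsWithin] with t' h2 h3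
    rw [position_of_not_onCircle hc,
      position_of_not_onCircle fun h => hc (hγ.onCircle h3.1 ht h)]
    exact ⟨hm ht h3.1 h3.2, h2⟩

end IsTrajectory

/-! ### The self-insertion map -/

lemma angle_coe {x : ℝ} (hx : x ∈ Ico (0 : ℝ) 10) : angle (x : AddCircle (10 : ℝ)) = x := by
  have := (AddCircle.equivIco (10 : ℝ) 0).apply_symm_apply ⟨x, by simpa using hx⟩
  exact congrArg Subtype.val this

lemma coe_angle (x : AddCircle (10 : ℝ)) : (angle x : AddCircle (10 : ℝ)) = x :=
  AddCircle.coe_equivIco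

lemma sigma_of_lower {p : F} (hp : p ∈ lowerDomain) : sigma p = lowerPoint (lowerFormula p) :=
  if_pos hp

lemma sigma_of_not_lower {p : F} (hp : p ∉ lowerDomain) :
    sigma p = upperPoint (upperFormula p) :=
  if_neg hp

lemma lowerPoint_coords {x : ℝ × ℝ × ℝ} (hx : x ∈ box) :
    radius (lowerPoint x) = x.1 ∧ height (lowerPoint x) = x.2.2 :=
  ⟨radius_point hx.1, height_point ⟨hx.2.1, by linarith [hx.2.2]⟩⟩

lemma upperPoint_coords {x : ℝ × ℝ × ℝ} (hx : x ∈ box) :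
    radius (upperPoint x) = x.1 ∧ height (upperPoint x) = x.2.2 + 2 :=
  ⟨radius_point hx.1, height_point ⟨by linarith [hx.2.1], by linarith [hx.2.2]⟩⟩

/-- The self-insertion map does not increase the radius. -/
lemma radius_sigma_le {p : F} (hp : p ∈ D) : radius (sigma p) ≤ p.1 := by
  by_cases hl : p ∈ lowerDomain
  · rw [sigma_of_lower hl, (lowerPoint_coords hl).1]
    simp only [lowerFormula]
    nlinarith [sq_nonneg (p.1 : ℝ), sq_nonneg (angle p.2 - 2)]
  · have hu := hp.resolve_left hl
    rw [sigma_of_not_lower hl, (upperPoint_coords hu).1]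
    simp only [upperFormula]
    nlinarith [sq_nonneg (p.1 : ℝ), sq_nonneg (angle p.2 - 8)]

/-- The radius is kept only where the self-insertion map meets the circular leaves. -/
lemma isCut_sigma {p : F} (hp : p ∈ D) (h : radius (sigma p) = p.1) : IsCut (sigma p) := by
  by_cases hl : p ∈ lowerDomain
  · rw [sigma_of_lower hl, (lowerPoint_coords hl).1] at h
    simp only [lowerFormula] at h
    have hr : (p.1 : ℝ) = 0 := by nlinarith [sq_nonneg (p.1 : ℝ), sq_nonneg (angle p.2 - 2)]
    have ha : angle p.2 = 2 := by nlinarith [sq_nonneg (p.1 : ℝ), sq_nonneg (angle p.2 - 2)]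
    left
    rw [sigma_of_lower hl]
    simp [lowerPoint, lowerFormula, hr, ha]
  · have hu := hp.resolve_left hl
    rw [sigma_of_not_lower hl, (upperPoint_coords hu).1] at h
    simp only [upperFormula] at h
    have hr : (p.1 : ℝ) = 0 := by nlinarith [sq_nonneg (p.1 : ℝ), sq_nonneg (angle p.2 - 8)]
    have ha : angle p.2 = 8 := by nlinarith [sq_nonneg (p.1 : ℝ), sq_nonneg (angle p.2 - 8)]
    right
    rw [sigma_of_not_lower hl]
    simp [upperPoint, upperFormula, hr, ha]

lemma eq_zero_of_onCircle_sigma {p : F} (hp : p ∈ D) (h : OnCircle (sigma p)) : (p.1 : ℝ) = 0 := by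
  obtain ⟨h1, h2⟩ := h
  have hb := p.1.2
  rw [fold_eq_zero] at h2
  by_cases hl : p ∈ lowerDomain
  · have hz := hl.2
    rw [sigma_of_lower hl, (lowerPoint_coords hl).1] at h1
    rw [sigma_of_lower hl, (lowerPoint_coords hl).2] at h2
    simp only [lowerFormula] at h1 h2 hz
    have ha : angle p.2 = 2 := by
      rcases h2 with h2 | h2
      · linarith
      · linarith [hz.2]
    rw [ha] at h1
    nlinarith [hb.1, hb.2, mul_eq_zero.1 (show (p.1 : ℝ) * (4 - p.1) = 0 by linarith)]
  · have hu := hp.resolve_left hl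
    have hz := hu.2
    rw [sigma_of_not_lower hl, (upperPoint_coords hu).1] at h1
    rw [sigma_of_not_lower hl, (upperPoint_coords hu).2] at h2
    simp only [upperFormula] at h1 h2 hz
    have ha : angle p.2 = 8 := by
      rcases h2 with h2 | h2
      · linarith [hz.1]
      · linarith
    rw [ha] at h1
    nlinarith [hb.1, hb.2, mul_eq_zero.1 (show (p.1 : ℝ) * (4 - p.1) = 0 by linarith)]

lemma IsCut.onCircle {w : W} (h : IsCut w) : OnCircle w := by
  rcases h with rfl | rfl
  · refine ⟨radius_point (by norm_num), ?_⟩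
    rw [height_point (by norm_num), fold_of_le (by norm_num)]
  · refine ⟨radius_point (by norm_num), ?_⟩
    rw [height_point (by norm_num), fold_of_ge (by norm_num)]
    norm_num

/-- The circular leaves are cut open at values of the self-insertion map. -/
lemma IsCut.exists_sigma {w : W} (h : IsCut w) : ∃ p ∈ D, sigma p = w := by
  let o : Icc (-1 : ℝ) 1 := ⟨0, by norm_num⟩
  rcases h with rfl | rfl
  · have ha : angle ((2 : ℝ) : AddCircle (10 : ℝ)) = 2 := angle_coe (by norm_num)
    have hf : lowerFormula (o, ((2 : ℝ) : AddCircle (10 : ℝ))) = (0, 6, 0) := by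
      simp [o, lowerFormula, ha]
    have hl : (o, ((2 : ℝ) : AddCircle (10 : ℝ))) ∈ lowerDomain := by
      rw [lowerDomain, mem_ofPred_eq, hf]
      exact ⟨by norm_num, by norm_num⟩
    exact ⟨_, Or.inl hl, by rw [sigma_of_lower hl, hf]; rfl⟩
  · have ha : angle ((8 : ℝ) : AddCircle (10 : ℝ)) = 8 := angle_coe (by norm_num)
    have hf : upperFormula (o, ((8 : ℝ) : AddCircle (10 : ℝ))) = (0, 4, 0) := by
      simp [o, upperFormula, ha]
    have hu : (o, ((8 : ℝ) : AddCircle (10 : ℝ))) ∈ upperDomain := by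
      rw [upperDomain, mem_ofPred_eq, hf]
      exact ⟨by norm_num, by norm_num⟩
    have hl : (o, ((8 : ℝ) : AddCircle (10 : ℝ))) ∉ lowerDomain := by
      intro h
      have := h.2.1
      simp only [lowerFormula, ha] at this
      norm_num at this
    exact ⟨_, Or.inr hu, by rw [sigma_of_not_lower hl, hf]; simp [upperPoint]⟩

/-- The domain of the self-insertion map stays away from the angle `0`, where the representatives
of angles jump. -/
lemma isCompact_D : IsCompact D := by
  have key : ∀ c : ℝ, IsCompact ((fun x : Icc (-1 : ℝ) 1 × ℝ =>
      ((x.1, (x.2 : AddCircle (10 : ℝ))) : F)) '' (univ ×ˢ Icc (c - 1) (c + 1) ∩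
        {x | (x.1 : ℝ) - 1 / 4 * (x.1 : ℝ) ^ 2 - 2 * (x.2 - c) ^ 2 ∈ Icc (-1 : ℝ) 1})) := by
    intro c
    refine ((isCompact_univ.prod isCompact_Icc).inter_right
      (isClosed_Icc.preimage (by fun_prop))).image ?_
    exact continuous_fst.prodMk ((AddCircle.continuous_mk' 10).comp continuous_snd)
  refine IsCompact.union ?_ ?_
  · convert key 2 using 1
    ext p
    constructor
    · rintro ⟨h1, h2⟩
      simp only [lowerFormula] at h1 h2
      exact ⟨(p.1, angle p.2), ⟨⟨mem_univ _, by constructor <;> linarith [h2.1, h2.2]⟩, h1⟩,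
        Prod.ext rfl (coe_angle _)⟩
    · rintro ⟨x, ⟨⟨-, hx⟩, h1⟩, rfl⟩
      have ha : angle (x.2 : AddCircle (10 : ℝ)) = x.2 :=
        angle_coe ⟨by linarith [hx.1], by linarith [hx.2]⟩
      refine ⟨?_, ?_⟩ <;> simp only [lowerFormula, ha]
      · exact h1
      · constructor <;> linarith [hx.1, hx.2]
  · convert key 8 using 1
    ext p
    constructor
    · rintro ⟨h1, h2⟩
      simp only [upperFormula] at h1 h2
      exact ⟨(p.1, angle p.2), ⟨⟨mem_univ _, by constructor <;> linarith [h2.1, h2.2]⟩, h1⟩,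
        Prod.ext rfl (coe_angle _)⟩
    · rintro ⟨x, ⟨⟨-, hx⟩, h1⟩, rfl⟩
      have ha : angle (x.2 : AddCircle (10 : ℝ)) = x.2 :=
        angle_coe ⟨by linarith [hx.1], by linarith [hx.2]⟩
      refine ⟨?_, ?_⟩ <;> simp only [upperFormula, ha]
      · exact h1
      · constructor <;> linarith [hx.1, hx.2]

/-! ### The leaves near the inserted fibres -/

namespace SelfInsertion

variable (S : SelfInsertion)

lemma continuousOn_thick : ContinuousOn S.thick DI :=
  continuousOn_iff_continuous_domRestrict.2 S.isEmbedding_thick.continuous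

lemma injOn_thick : InjOn S.thick DI :=
  injOn_iff_injective.2 S.isEmbedding_thick.injective

lemma thick_mem {p : F} (hp : p ∈ D) (s : unitInterval) : S.thick (p, s) ∈ S.thick '' DI :=
  mem_image_of_mem _ ⟨hp, mem_univ s⟩

lemma eq_of_thick_eq {p p' : F} (hp : p ∈ D) (hp' : p' ∈ D) {s s' : unitInterval}
    (h : S.thick (p, s) = S.thick (p', s')) : p = p' ∧ s = s' :=
  Prod.mk.inj (S.injOn_thick (show (p, s) ∈ DI from ⟨hp, mem_univ s⟩)
    (show (p', s') ∈ DI from ⟨hp', mem_univ s'⟩) h)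

lemma isClosed_image_thick : IsClosed (S.thick '' DI) :=
  ((isCompact_D.prod isCompact_univ).image_of_continuousOn S.continuousOn_thick).isClosed

lemma isClosed_image_thick_section (s : unitInterval) :
    IsClosed ((fun p => S.thick (p, s)) '' D) :=
  (isCompact_D.image_of_continuousOn (S.continuousOn_thick.comp
    (continuous_id.prodMk continuous_const).continuousOn
    fun _ hp => ⟨hp, mem_univ _⟩)).isClosed

lemma leafLabel_thick {p : F} (hp : p ∈ D) (s s' : unitInterval) :
    leafLabel (S.thick (p, s)) = leafLabel (S.thick (p, s')) := by
  obtain ⟨b, γ, u, hγ, -, -, hu⟩ := S.thick_leaf p hp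
  rw [(hu s).2, (hu s').2]
  exact hγ.leafLabel_eq (hu s).1 (hu s').1

lemma radius_thick_le {p : F} (hp : p ∈ D) (s : unitInterval) :
    radius (S.thick (p, s)) ≤ p.1 := by
  rw [radius_eq_of_leafLabel_eq (S.leafLabel_thick hp s 0), S.thick_zero p hp]
  exact radius_sigma_le hp

lemma onCircle_thick {p : F} (hp : p ∈ D) {s : unitInterval}
    (h : radius (S.thick (p, s)) = p.1) : OnCircle (S.thick (p, s)) := by
  rw [onCircle_iff_of_leafLabel_eq (S.leafLabel_thick hp s 0), S.thick_zero p hp]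
  rw [radius_eq_of_leafLabel_eq (S.leafLabel_thick hp s 0), S.thick_zero p hp] at h
  exact (isCut_sigma hp h).onCircle

lemma eq_zero_of_onCircle_thick {p : F} (hp : p ∈ D) {s : unitInterval}
    (h : OnCircle (S.thick (p, s))) : (p.1 : ℝ) = 0 := by
  rw [onCircle_iff_of_leafLabel_eq (S.leafLabel_thick hp s 0), S.thick_zero p hp] at h
  exact eq_zero_of_onCircle_sigma hp h

lemma exists_thick_of_isCut {w : W} (h : IsCut w) : ∃ p ∈ D, w = S.thick (p, 0) := by
  obtain ⟨p, hp, rfl⟩ := h.exists_sigma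
  exact ⟨p, hp, (S.thick_zero p hp).symm⟩

/-- Away from the circles, the positions of an inserted fibre fill an interval. -/
lemma exists_thick_of_position {p : F} (hp : p ∈ D) (hc : (p.1 : ℝ) ≠ 0) :
    position (S.thick (p, 0)) < position (S.thick (p, 1)) ∧
    ∀ w, leafLabel w = leafLabel (S.thick (p, 0)) → position (S.thick (p, 0)) ≤ position w →
      position w ≤ position (S.thick (p, 1)) → ∃ s, w = S.thick (p, s) := by
  have hc' : ∀ s, ¬ OnCircle (S.thick (p, s)) := fun s h => hc (S.eq_zero_of_onCircle_thick hp h)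
  have hpos : ∀ s, position (S.thick (p, s)) = height (S.thick (p, s)) :=
    fun s => position_of_not_onCircle (hc' s)
  constructor
  · obtain ⟨b, γ, u, hγ, -, hmono, hu⟩ := S.thick_leaf p hp
    rw [hpos, hpos, (hu 0).2, (hu 1).2]
    exact hγ.strictMonoOn_height (hu 0).1 ((hu 0).2 ▸ hc' 0) (hu 0).1 (hu 1).1
      (hmono zero_lt_one)
  · intro w hl h0 h1
    have hcont : Continuous fun s : unitInterval => position (S.thick (p, s)) := by
      simp only [hpos]
      have : Continuous fun s : unitInterval => S.thick (p, s) :=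
        S.continuousOn_thick.comp_continuous (by fun_prop) fun s => ⟨hp, mem_univ _⟩
      exact continuous_subtype_val.comp (continuous_snd.comp this)
    obtain ⟨s, -, hs⟩ := intermediate_value_Icc (zero_le_one (α := unitInterval))
      hcont.continuousOn ⟨h0, h1⟩
    exact ⟨s, (eq_of_position_eq ((S.leafLabel_thick hp s 0).trans hl.symm) hs).symm⟩

variable {a b : ℝ} {γ : ℝ → W}

lemma eventually_thick_right (hγ : IsTrajectory a b γ) {t : ℝ} (ht : t ∈ Icc a b) {p : F}
    (hp : p ∈ D) {s : unitInterval} (hs : s < 1) (h : γ t = S.thick (p, s)) {V : Set unitInterval}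
    (hV : V ∈ 𝓝 s) :
    ∀ᶠ t' in 𝓝[Icc a b ∩ Ici t] t, ∃ s' ∈ V, γ t' = S.thick (p, s') := by
  obtain ⟨b', γ', u, hγ', huc, hum, hu⟩ := S.thick_leaf p hp
  obtain ⟨s₁, hs₁, hsub⟩ := (mem_nhdsGE_iff_exists_mem_Ioc_Ico_subset hs).1
    (mem_nhdsWithin_of_mem_nhds hV)
  have hlt : t < t + (u s₁ - u s) := by linarith [hum hs₁.1]
  filter_upwards [mem_nhdsWithin_of_mem_nhds (Iio_mem_nhds hlt), self_mem_nhdsWithin]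
    with t' h1 ⟨h2, h3⟩
  have h1' : t' < t + (u s₁ - u s) := h1
  have h3' : t ≤ t' := h3
  obtain ⟨s', hs', he⟩ := intermediate_value_Ico hs₁.1.le huc.continuousOn
    (show u s + (t' - t) ∈ Ico (u s) (u s₁) from ⟨by linarith, by linarith⟩)
  refine ⟨s', hsub hs', ?_⟩
  have := hγ.unique hγ' (δ := t' - t) ht (hu s).1 (h.trans (hu s).2) (by simpa using h2)
    (he ▸ (hu s').1)
  rw [add_sub_cancel] at this
  rw [this, ← he, (hu s').2]

lemma eventually_thick_left (hγ : IsTrajectory a b γ) {t : ℝ} (ht : t ∈ Icc a b) {p : F}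
    (hp : p ∈ D) {s : unitInterval} (hs : 0 < s) (h : γ t = S.thick (p, s)) {V : Set unitInterval}
    (hV : V ∈ 𝓝 s) :
    ∀ᶠ t' in 𝓝[Icc a b ∩ Iic t] t, ∃ s' ∈ V, γ t' = S.thick (p, s') := by
  obtain ⟨b', γ', u, hγ', huc, hum, hu⟩ := S.thick_leaf p hp
  obtain ⟨s₁, hs₁, hsub⟩ := (mem_nhdsLE_iff_exists_mem_Ico_Ioc_subset hs).1
    (mem_nhdsWithin_of_mem_nhds hV)
  have hlt : t + (u s₁ - u s) < t := by linarith [hum hs₁.2]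
  filter_upwards [mem_nhdsWithin_of_mem_nhds (Ioi_mem_nhds hlt), self_mem_nhdsWithin]
    with t' h1 ⟨h2, h3⟩
  have h1' : t + (u s₁ - u s) < t' := h1
  have h3' : t' ≤ t := h3
  obtain ⟨s', hs', he⟩ := intermediate_value_Ioc hs₁.2.le huc.continuousOn
    (show u s + (t' - t) ∈ Ioc (u s₁) (u s) from ⟨by linarith, by linarith⟩)
  refine ⟨s', hsub hs', ?_⟩
  have := hγ.unique hγ' (δ := t' - t) ht (hu s).1 (h.trans (hu s).2) (by simpa using h2)
    (he ▸ (hu s').1)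
  rw [add_sub_cancel] at this
  rw [this, ← he, (hu s').2]

/-- Just after leaving an inserted fibre at its end, a trajectory is outside all inserted fibres. -/
lemma eventually_notMem_right (hγ : IsTrajectory a b γ) {t : ℝ} (ht : t ∈ Icc a b) {p : F}
    (hp : p ∈ D) (h : γ t = S.thick (p, 1)) :
    ∀ᶠ t' in 𝓝[Icc a b ∩ Ioi t] t, γ t' ∉ S.thick '' DI := by
  have hne : γ t ∉ (fun p => S.thick (p, 0)) '' D := by
    rintro ⟨p', hp', he⟩
    exact zero_ne_one (S.eq_of_thick_eq hp' hp (he.trans h)).2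
  have hev := hγ.continuousOn t ht ((S.isClosed_image_thick_section 0).isOpen_compl.mem_nhds hne)
  obtain ⟨ε, hε, hball⟩ := Metric.mem_nhdsWithin_iff.1 hev
  filter_upwards [mem_nhdsWithin_of_mem_nhds (Metric.ball_mem_nhds t hε), self_mem_nhdsWithin]
    with t' h1 ⟨h2, h3⟩
  rintro ⟨⟨p', s'⟩, ⟨hp', -⟩, he⟩
  have h3' : t < t' := h3
  rw [Metric.mem_ball, Real.dist_eq, abs_of_pos (by linarith)] at h1
  -- Follow the inserted fibre through `γ t'` backwards.
  obtain ⟨b', γ', u, hγ', huc, hum, hu⟩ := S.thick_leaf p' hp'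
  rcases le_or_gt (t' - t) (u s' - u 0) with hle | hlt
  · obtain ⟨s'', -, he''⟩ := intermediate_value_Icc (bot_le : (0 : unitInterval) ≤ s')
      huc.continuousOn
      (show u s' - (t' - t) ∈ Icc (u 0) (u s') from ⟨by linarith, by linarith⟩)
    have := hγ.unique hγ' (δ := -(t' - t)) h2 (hu s').1 (he.symm.trans (hu s').2)
      (by simpa using ht) (by rw [← sub_eq_add_neg, ← he'']; exact (hu s'').1)
    rw [← sub_eq_add_neg, ← sub_eq_add_neg, sub_sub_cancel, ← he'', ← (hu s'').2, h] at this
    have h1s := (S.eq_of_thick_eq hp hp' this).2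
    have hlt : s'' < s' := hum.lt_iff_lt.1 (by linarith)
    exact absurd (h1s ▸ hlt) (not_lt.2 le_top)
  · have h0 : u 0 ≤ u s' := hum.monotone bot_le
    have hI : t' + (u 0 - u s') ∈ Icc a b :=
      ⟨by linarith [ht.1], by linarith [h2.2]⟩
    have := hγ.unique hγ' (δ := u 0 - u s') h2 (hu s').1 (he.symm.trans (hu s').2) hI
      (by rw [add_sub_cancel]; exact (hu 0).1)
    rw [add_sub_cancel, ← (hu 0).2] at this
    refine hball ⟨?_, hI⟩ ⟨p', hp', this.symm⟩
    rw [Metric.mem_ball, Real.dist_eq, abs_of_pos (by linarith)]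
    linarith

/-- Just before entering an inserted fibre, a trajectory is outside all inserted fibres. -/
lemma eventually_notMem_left (hγ : IsTrajectory a b γ) {t : ℝ} (ht : t ∈ Icc a b) {p : F}
    (hp : p ∈ D) (h : γ t = S.thick (p, 0)) :
    ∀ᶠ t' in 𝓝[Icc a b ∩ Iio t] t, γ t' ∉ S.thick '' DI := by
  have hne : γ t ∉ (fun p => S.thick (p, 1)) '' D := by
    rintro ⟨p', hp', he⟩
    exact one_ne_zero (S.eq_of_thick_eq hp' hp (he.trans h)).2
  have hev := hγ.continuousOn t ht ((S.isClosed_image_thick_section 1).isOpen_compl.mem_nhds hne)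
  obtain ⟨ε, hε, hball⟩ := Metric.mem_nhdsWithin_iff.1 hev
  filter_upwards [mem_nhdsWithin_of_mem_nhds (Metric.ball_mem_nhds t hε), self_mem_nhdsWithin]
    with t' h1 ⟨h2, h3⟩
  rintro ⟨⟨p', s'⟩, ⟨hp', -⟩, he⟩
  have h3' : t' < t := h3
  rw [Metric.mem_ball, Real.dist_eq, abs_of_neg (by linarith)] at h1
  obtain ⟨b', γ', u, hγ', huc, hum, hu⟩ := S.thick_leaf p' hp'
  rcases le_or_gt (t - t') (u 1 - u s') with hle | hlt
  · obtain ⟨s'', -, he''⟩ := intermediate_value_Icc (le_top : s' ≤ (1 : unitInterval))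
      huc.continuousOn
      (show u s' + (t - t') ∈ Icc (u s') (u 1) from ⟨by linarith, by linarith⟩)
    have := hγ.unique hγ' (δ := t - t') h2 (hu s').1 (he.symm.trans (hu s').2)
      (by simpa using ht) (by rw [← he'']; exact (hu s'').1)
    rw [add_sub_cancel, ← he'', ← (hu s'').2, h] at this
    have h1s := (S.eq_of_thick_eq hp hp' this).2
    have hlt : s' < s'' := hum.lt_iff_lt.1 (by linarith)
    exact absurd (h1s ▸ hlt) (not_lt.2 bot_le)
  · have h0 : u s' ≤ u 1 := hum.monotone le_top
    have hI : t' + (u 1 - u s') ∈ Icc a b :=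
      ⟨by linarith [h2.1], by linarith [ht.2]⟩
    have := hγ.unique hγ' (δ := u 1 - u s') h2 (hu s').1 (he.symm.trans (hu s').2) hI
      (by rw [add_sub_cancel]; exact (hu 1).1)
    rw [add_sub_cancel, ← (hu 1).2] at this
    refine hball ⟨?_, hI⟩ ⟨p', hp', this.symm⟩
    rw [Metric.mem_ball, Real.dist_eq, abs_of_neg (by linarith)]
    linarith

end SelfInsertion

/-! ### The leaf topology of the self-inserted plug -/

lemma isOpen_leafTopology_iff {O : Set W} :
    IsOpen[leafTopology] O ↔ ∀ (a b : ℝ) (γ : ℝ → W), IsTrajectory a b γ → ∀ t ∈ Icc a b, γ t ∈ O →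
      ∀ᶠ t' in 𝓝[Icc a b] t, γ t' ∈ O := by
  simp only [isOpen_iSup_iff, isOpen_coinduced]
  refine forall₄_congr fun a b γ hγ => ?_
  rw [isOpen_iff_mem_nhds, Subtype.forall]
  refine forall₂_congr fun t ht => imp_congr_right fun _ => ?_
  rw [nhdsWithin_eq_map_subtype_coe ht, Filter.eventually_map]
  rfl

namespace SelfInsertion

variable (S : SelfInsertion)

open Classical in
/-- The gluing retracts what remains of the plug to the complement of the inserted fibres, by
`σ x ↦ α x`. -/
def retract (w : W) : W := if h : ∃ x ∈ DI ∩ S.N, S.thick x = w then S.attach h.choose else w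

lemma retract_thick {x : F × unitInterval} (hx : x ∈ DI ∩ S.N) :
    S.retract (S.thick x) = S.attach x := by
  have h : ∃ y ∈ DI ∩ S.N, S.thick y = S.thick x := ⟨x, hx, rfl⟩
  rw [retract, dif_pos h, S.injOn_thick h.choose_spec.1.1 hx.1 h.choose_spec.2]

lemma retract_of_notMem {w : W} (hw : w ∉ S.thick '' DI) : S.retract w = w :=
  dif_neg fun ⟨x, hx, h⟩ => hw ⟨x, hx.1, h⟩

lemma attach_notMem {x : F × unitInterval} (hx : x ∈ DI ∩ S.N) : S.attach x ∉ S.thick '' DI :=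
  fun h => S.disjoint_thick_attach.notMem_of_mem_left h (subset_closure (mem_image_of_mem _ hx))

/-- The points of the self-inserted plug, as points of the plug outside the inserted fibres. -/
def toPlug : S.Hat → W :=
  Quot.lift (fun w : S.Rest => S.retract w.1) fun v w ⟨x, hx, hv, hw⟩ => by
    rw [hv, hw, S.retract_thick hx, S.retract_of_notMem (S.attach_notMem hx)]

lemma toPlug_mk (v : S.Rest) : S.toPlug (Quot.mk _ v) = S.retract v.1 := rfl

lemma exists_rest (v : S.Rest) : ∃ w : S.Rest, w.1 = S.toPlug (Quot.mk _ v) ∧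
    w.1 ∉ S.thick '' DI ∧ Quot.mk S.Glue v = Quot.mk S.Glue w := by
  by_cases h : ∃ x ∈ DI ∩ S.N, S.thick x = v.1
  · obtain ⟨x, hx, hv⟩ := h
    have hn := S.attach_notMem hx
    exact ⟨⟨S.attach x, fun h => hn (image_mono (f := S.thick) sdiff_subset h)⟩,
      by rw [toPlug_mk, ← hv, S.retract_thick hx], hn, Quot.sound ⟨x, hx, hv.symm, rfl⟩⟩
  · have hn : v.1 ∉ S.thick '' DI := by
      rintro ⟨x, hx, hv⟩
      by_cases hN : x ∈ S.N
      · exact h ⟨x, ⟨hx, hN⟩, hv⟩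
      · exact v.2 ⟨x, ⟨hx, hN⟩, hv⟩
    exact ⟨v, (S.retract_of_notMem hn).symm, hn, rfl⟩

lemma toPlug_notMem (x : S.Hat) : S.toPlug x ∉ S.thick '' DI := by
  induction x using Quot.ind with
  | mk v =>
    obtain ⟨w, h1, h2, -⟩ := S.exists_rest v
    rwa [← h1]

lemma toPlug_injective : Function.Injective S.toPlug := by
  intro x y h
  induction x using Quot.ind with
  | mk v =>
    induction y using Quot.ind with
    | mk v' =>
      obtain ⟨w, h1, -, h2⟩ := S.exists_rest v
      obtain ⟨w', h1', -, h2'⟩ := S.exists_rest v'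
      rw [h2, h2', Subtype.ext (h1.trans (h.trans h1'.symm))]

lemma isClosed_removed : IsClosed (S.thick '' (DI \ S.N)) :=
  (((isCompact_D.prod isCompact_univ).diff S.isOpen_N).image_of_continuousOn
    (S.continuousOn_thick.mono sdiff_subset)).isClosed

/-- A criterion for openness in the leaf topology of the self-inserted plug. Outside the inserted
fibres, the trajectories of the plug are continuous; a trajectory that arrives at the start of an
inserted fibre is continued from the bottom of the plug, and a trajectory that leaves the end of an
inserted fibre has come from the top of the plug. -/
theorem isOpen_preimage_toPlug {P : Set W}
    (hP : ∀ (a b : ℝ) (γ : ℝ → W), IsTrajectory a b γ → ∀ t ∈ Icc a b, γ t ∉ S.thick '' DI →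
      γ t ∈ P → ∀ᶠ t' in 𝓝[Icc a b] t, γ t' ∈ P)
    (hbot : ∀ (a b : ℝ) (γ : ℝ → W), IsTrajectory a b γ → ∀ t ∈ Icc a b, ∀ p ∈ D,
      γ t = S.thick (p, 0) → bottom p ∈ P → ∀ᶠ t' in 𝓝[Icc a b ∩ Iio t] t, γ t' ∈ P)
    (htop : ∀ (a b : ℝ) (γ : ℝ → W), IsTrajectory a b γ → ∀ t ∈ Icc a b, ∀ p ∈ D,
      γ t = S.thick (p, 1) → top p ∈ P → ∀ᶠ t' in 𝓝[Icc a b ∩ Ioi t] t, γ t' ∈ P) :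
    IsOpen[S.hatLeafTopology] (S.toPlug ⁻¹' P) := by
  have hO₀ : IsOpen[leafTopology] (P \ S.thick '' DI) := by
    refine isOpen_leafTopology_iff.2 fun a b γ hγ t ht hm => ?_
    exact (hP a b γ hγ t ht hm.2 hm.1).and
      (hγ.continuousOn t ht (S.isClosed_image_thick.isOpen_compl.mem_nhds hm.2))
  have hO : IsOpen[leafTopology] {w | w ∉ S.thick '' (DI \ S.N) ∧ S.retract w ∈ P} := by
    refine isOpen_leafTopology_iff.2 fun a b γ hγ t ht hm => ?_
    have h1 : ∀ᶠ t' in 𝓝[Icc a b] t, γ t' ∉ S.thick '' (DI \ S.N) :=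
      hγ.continuousOn t ht (S.isClosed_removed.isOpen_compl.mem_nhds hm.1)
    refine h1.and ?_
    by_cases hx : γ t ∈ S.thick '' DI
    · obtain ⟨⟨p, s⟩, hps, hx⟩ := hx
      have hp : p ∈ D := hps.1
      have hN : (p, s) ∈ S.N := by
        by_contra hN
        exact hm.1 ⟨(p, s), ⟨hps, hN⟩, hx⟩
      have hs : S.attach (p, s) ∈ P := by
        have := hm.2
        rwa [← hx, S.retract_thick ⟨hps, hN⟩] at this
      -- The fibrewise continuity of the attaching map handles the points of the same fibre.
      have hV : {s' | (p, s') ∈ S.N ∧ S.attach (p, s') ∈ P} ∈ 𝓝 s := by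
        have hNs : IsOpen {s' | (p, s') ∈ S.N} :=
          S.isOpen_N.preimage (by fun_prop : Continuous fun s' : unitInterval => (p, s'))
        have hc := (@continuous_def _ _ _ leafTopology _).1 (S.attach_leaf p) _ hO₀
        have := (hNs.isOpenMap_subtype_val _ hc).mem_nhds
          ⟨⟨s, hN⟩, ⟨hs, S.attach_notMem ⟨hps, hN⟩⟩, rfl⟩
        filter_upwards [this]
        rintro _ ⟨s', hs', rfl⟩
        exact ⟨s'.2, hs'.1⟩
      have hfib : ∀ t', (∃ s' ∈ {s' | (p, s') ∈ S.N ∧ S.attach (p, s') ∈ P},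
          γ t' = S.thick (p, s')) → S.retract (γ t') ∈ P := by
        rintro t' ⟨s', hs', he⟩
        rw [he, S.retract_thick ⟨⟨hp, mem_univ s'⟩, hs'.1⟩]
        exact hs'.2
      have hright : ∀ᶠ t' in 𝓝[Icc a b ∩ Ioi t] t, S.retract (γ t') ∈ P := by
        rcases lt_or_eq_of_le (unitInterval.le_one' : s ≤ 1) with h | h
        · exact ((S.eventually_thick_right hγ ht hp h hx.symm hV).filter_mono
            (nhdsWithin_mono t (inter_subset_inter_right _ Ioi_subset_Ici_self))).mono hfib
        · rw [h] at hx hs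
          rw [S.attach_one] at hs
          filter_upwards [S.eventually_notMem_right hγ ht hp hx.symm,
            htop a b γ hγ t ht p hp hx.symm hs] with t' h1 h2
          rwa [S.retract_of_notMem h1]
      have hleft : ∀ᶠ t' in 𝓝[Icc a b ∩ Iio t] t, S.retract (γ t') ∈ P := by
        rcases lt_or_eq_of_le (unitInterval.nonneg' : 0 ≤ s) with h | h
        · exact ((S.eventually_thick_left hγ ht hp h hx.symm hV).filter_mono
            (nhdsWithin_mono t (inter_subset_inter_right _ Iio_subset_Iic_self))).mono hfib
        · rw [← h] at hx hs
          rw [S.attach_zero] at hs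
          filter_upwards [S.eventually_notMem_left hγ ht hp hx.symm,
            hbot a b γ hγ t ht p hp hx.symm hs] with t' h1 h2
          rwa [S.retract_of_notMem h1]
      rw [eventually_nhdsWithin_iff] at hleft hright ⊢
      filter_upwards [hleft, hright] with t' hl hr ht'
      rcases lt_trichotomy t' t with h | h | h
      · exact hl ⟨ht', h⟩
      · rw [h]; exact hm.2
      · exact hr ⟨ht', h⟩
    · have h2 : ∀ᶠ t' in 𝓝[Icc a b] t, γ t' ∉ S.thick '' DI :=
        hγ.continuousOn t ht (S.isClosed_image_thick.isOpen_compl.mem_nhds hx)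
      have hm2 := hm.2
      rw [S.retract_of_notMem hx] at hm2
      filter_upwards [h2, hP a b γ hγ t ht hx hm2] with t' h h'
      rwa [S.retract_of_notMem h]
  refine isOpen_coinduced.2 ((@isOpen_induced_iff _ _ leafTopology _ _).2 ⟨_, hO, ?_⟩)
  ext v
  exact and_iff_right v.2

end SelfInsertion

/-! ### The forest of leaves -/

lemma fold_height_bottom (p : F) : fold (height (bottom p)) = -1 := by
  rw [show height (bottom p) = -1 from rfl, fold_of_le (by norm_num)]

lemma fold_height_top (p : F) : fold (height (top p)) = -1 := by
  rw [show height (top p) = 3 from rfl, fold_of_ge (by norm_num)]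
  norm_num

lemma not_onCircle_bottom (p : F) : ¬ OnCircle (bottom p) := fun h => by
  have := h.2
  rw [fold_height_bottom] at this
  norm_num at this

lemma not_onCircle_top (p : F) : ¬ OnCircle (top p) := fun h => by
  have := h.2
  rw [fold_height_top] at this
  norm_num at this

lemma phase_top (p : F) : phase (top p) = phase (bottom p) := by
  rw [phase, phase, fold_height_bottom, fold_height_top]
  rfl

/-- The mirror symmetry of the plug: a leaf that traverses the plug leaves it over the point where it
has entered. -/
lemma leafLabel_top {p : F} (hp : (p.1 : ℝ) ≠ 0) : leafLabel (top p) = leafLabel (bottom p) :=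
  leafLabel_eq rfl (fun h => absurd h hp) fun _ => phase_top p

lemma eq_of_phase_bottom_eq {p p' : F} (hr : (p.1 : ℝ) = p'.1)
    (hp : phase (bottom p) = phase (bottom p')) : p = p' := by
  rw [phase, phase, fold_height_bottom, fold_height_bottom, show radius (bottom p) = radius
    (bottom p') from hr, sub_left_inj] at hp
  exact Prod.ext (Subtype.ext hr) hp

lemma leafLabel_top_ne {p : F} (hp : (p.1 : ℝ) = 0) : leafLabel (top p) ≠ leafLabel (bottom p) := by
  intro h
  have := (sign_eq_of_leafLabel_eq h hp).1
  rw [show height (top p) = 3 from rfl, show height (bottom p) = -1 from rfl,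
    sign_pos (by norm_num), sign_neg (by norm_num)] at this
  exact absurd this (by decide)

namespace SelfInsertion

variable (S : SelfInsertion)

/-- The leaf of `w` is inserted into the leaf of `v` at the point `v`: the leaf of `w` starts at the
bottom, and `v` is the corresponding start of an inserted fibre, or it only ends at the top (so that
its radius is `0`), and `v` is the corresponding end of an inserted fibre. -/
def InsertedAt (w v : W) : Prop :=
  ∃ p ∈ D, (leafLabel (bottom p) = leafLabel w ∧ v = S.thick (p, 0)) ∨
    ((p.1 : ℝ) = 0 ∧ leafLabel (top p) = leafLabel w ∧ v = S.thick (p, 1))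

/-- The points at which the leaf of `x`, the leaf into which it is inserted, and so on, are met:
`x` itself, the place of insertion of its leaf, and so on. -/
def Spine (x s : W) : Prop := Relation.ReflTransGen S.InsertedAt x s

variable {S}

lemma InsertedAt.congr {w w' v : W} (h : S.InsertedAt w v) (hl : leafLabel w = leafLabel w') :
    S.InsertedAt w' v := by
  rwa [InsertedAt, ← hl]

lemma InsertedAt.mem {w v : W} (h : S.InsertedAt w v) : v ∈ S.thick '' DI := by
  obtain ⟨p, hp, ⟨-, rfl⟩ | ⟨-, -, rfl⟩⟩ := h
  · exact S.thick_mem hp 0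
  · exact S.thick_mem hp 1

lemma InsertedAt.not_onCircle {w v : W} (h : S.InsertedAt w v) : ¬ OnCircle w := by
  obtain ⟨p, hp, ⟨h, -⟩ | ⟨-, h, -⟩⟩ := h
  · exact (onCircle_iff_of_leafLabel_eq h).not.1 (not_onCircle_bottom p)
  · exact (onCircle_iff_of_leafLabel_eq h).not.1 (not_onCircle_top p)

lemma InsertedAt.radius_le {w v : W} (h : S.InsertedAt w v) : radius v ≤ radius w := by
  obtain ⟨p, hp, ⟨h, rfl⟩ | ⟨-, h, rfl⟩⟩ := h
  · exact (S.radius_thick_le hp 0).trans (radius_eq_of_leafLabel_eq h).le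
  · exact (S.radius_thick_le hp 1).trans (radius_eq_of_leafLabel_eq h).le

lemma InsertedAt.onCircle {w v : W} (h : S.InsertedAt w v) (hr : radius v = radius w) :
    OnCircle v := by
  obtain ⟨p, hp, ⟨h, rfl⟩ | ⟨-, h, rfl⟩⟩ := h
  · exact S.onCircle_thick hp (hr.trans (radius_eq_of_leafLabel_eq h).symm)
  · exact S.onCircle_thick hp (hr.trans (radius_eq_of_leafLabel_eq h).symm)

lemma insertedAt_rightUnique : Relator.RightUnique S.InsertedAt := by
  intro w v v' h h'
  have hw := h.not_onCircle
  have key : ∀ {p : F}, (leafLabel (bottom p) = leafLabel w ∨ leafLabel (top p) = leafLabel w) →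
      (p.1 : ℝ) = radius w ∧ phase (bottom p) = phase w := by
    rintro p (h | h)
    · exact ⟨radius_eq_of_leafLabel_eq h, phase_eq_of_leafLabel_eq h hw⟩
    · exact ⟨radius_eq_of_leafLabel_eq h, (phase_top p) ▸ phase_eq_of_leafLabel_eq h hw⟩
  obtain ⟨p, hp, h⟩ := h
  obtain ⟨p', hp', h'⟩ := h'
  have k := key (h.imp And.left fun h => h.2.1)
  have k' := key (h'.imp And.left fun h => h.2.1)
  obtain rfl := eq_of_phase_bottom_eq (k.1.trans k'.1.symm) (k.2.trans k'.2.symm)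
  rcases h with ⟨h, rfl⟩ | ⟨h0, h, rfl⟩ <;> rcases h' with ⟨h', rfl⟩ | ⟨h0', h', rfl⟩
  · rfl
  · exact absurd (h'.trans h.symm) (leafLabel_top_ne h0')
  · exact absurd (h.trans h'.symm) (leafLabel_top_ne h0)
  · rfl

lemma Spine.radius_le {x s : W} (h : S.Spine x s) : radius s ≤ radius x := by
  induction h with
  | refl => exact le_rfl
  | tail _ h ih => exact h.radius_le.trans ih

lemma Spine.eq_of_notMem {x s : W} (h : S.Spine x s) (hs : s ∉ S.thick '' DI) : s = x := by
  rcases Relation.ReflTransGen.cases_tail h with rfl | ⟨_, _, h⟩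
  · rfl
  · exact absurd h.mem hs

/-- No leaf is inserted, directly or indirectly, into itself: insertion decreases the radius, except
for leaves inserted into the circles, which are not inserted anywhere. -/
lemma Spine.eq_of_leafLabel_eq {s s' : W} (h : S.Spine s s') (hl : leafLabel s = leafLabel s') :
    s = s' := by
  rcases Relation.ReflTransGen.cases_head h with rfl | ⟨v, hv, h'⟩
  · rfl
  · have hr : radius v = radius s := le_antisymm hv.radius_le
      ((radius_eq_of_leafLabel_eq hl).le.trans (Spine.radius_le h'))
    have hc := hv.onCircle hr
    rcases Relation.ReflTransGen.cases_head h' with rfl | ⟨v', hv', -⟩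
    · exact absurd ((onCircle_iff_of_leafLabel_eq hl).2 hc) hv.not_onCircle
    · exact absurd hc hv'.not_onCircle

lemma Spine.unique {x s s' : W} (h : S.Spine x s) (h' : S.Spine x s')
    (hl : leafLabel s = leafLabel s') : s = s' := by
  rcases Relation.ReflTransGen.total_of_right_unique insertedAt_rightUnique h h' with k | k
  · exact Spine.eq_of_leafLabel_eq k hl
  · exact (Spine.eq_of_leafLabel_eq k hl.symm).symm

lemma Spine.exists_of_thick {x : W} (hx : x ∉ S.thick '' DI) {p : F} (hp : p ∈ D)
    {s : unitInterval} (h : S.Spine x (S.thick (p, s))) :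
    ∃ v, S.Spine x v ∧ ((leafLabel (bottom p) = leafLabel v ∧ s = 0) ∨
      ((p.1 : ℝ) = 0 ∧ leafLabel (top p) = leafLabel v ∧ s = 1)) := by
  rcases Relation.ReflTransGen.cases_tail h with h | ⟨v, hv, p', hp', h⟩
  · exact absurd (h ▸ S.thick_mem hp s) hx
  · refine ⟨v, hv, ?_⟩
    rcases h with ⟨hl, he⟩ | ⟨h0, hl, he⟩ <;> obtain ⟨rfl, rfl⟩ := S.eq_of_thick_eq hp hp' he
    · exact Or.inl ⟨hl, rfl⟩
    · exact Or.inr ⟨h0, hl, rfl⟩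

/-! ### The order of points along leaves of the self-inserted plug -/

variable (S) in
/-- The point `y` lies after some point of the spine of `x` on the leaf of that point. -/
def Passed (x y : W) : Prop := ∃ s, S.Spine x s ∧ leafLabel s = leafLabel y ∧ position s < position y

variable (S) in
/-- The point `y` comes after the point `x`: on some leaf into which the leaves of both are inserted,
directly or indirectly, the place of `y` is after the place of `x`. -/
def After (x y : W) : Prop := ∃ v, S.Spine y v ∧ S.Passed x v

lemma after_asymm {x y : W} (h : S.After x y) (h' : S.After y x) : False := by
  obtain ⟨v, hv, s, hs, hl, hp⟩ := h
  obtain ⟨s', hs', v', hv', hl', hp'⟩ := h'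
  -- Once two spines meet the same leaf, they coincide from the next place of insertion on.
  have key : ∀ {y s s' v v' : W}, S.Spine y v → S.Spine y v' → leafLabel s = leafLabel v →
      leafLabel s' = leafLabel v' → S.Spine s s' → (s = s' ∧ v = v') ∨ s' = v' := by
    intro y s s' v v' hv hv' hl hl' hss
    rcases Relation.ReflTransGen.cases_head hss with rfl | ⟨u, hu, hus⟩
    · exact Or.inl ⟨rfl, Spine.unique hv hv' (hl.symm.trans hl')⟩
    · right
      exact Spine.unique ((Relation.ReflTransGen.tail hv (hu.congr hl)).trans hus) hv' hl'
  rcases Relation.ReflTransGen.total_of_right_unique insertedAt_rightUnique hs hs' with k | k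
  · rcases key hv hv' hl hl'.symm k with ⟨rfl, rfl⟩ | rfl
    · exact lt_asymm hp hp'
    · exact lt_irrefl _ hp'
  · rcases key hv' hv hl'.symm hl k with ⟨rfl, rfl⟩ | rfl
    · exact lt_asymm hp hp'
    · exact lt_irrefl _ hp

lemma after_iff {x w : W} : S.After x w ↔ S.Passed x w ∨ ∃ v, S.InsertedAt w v ∧ S.After x v := by
  constructor
  · rintro ⟨v, hv, h⟩
    rcases Relation.ReflTransGen.cases_head hv with rfl | ⟨u, hu, huv⟩
    · exact Or.inl h
    · exact Or.inr ⟨u, hu, v, huv, h⟩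
  · rintro (h | ⟨v, hv, u, hu, h⟩)
    · exact ⟨w, Relation.ReflTransGen.refl, h⟩
    · exact ⟨u, Relation.ReflTransGen.head hv hu, h⟩

lemma after_congr {x w w' : W} (hl : leafLabel w = leafLabel w')
    (hp : S.Passed x w ↔ S.Passed x w') : S.After x w ↔ S.After x w' := by
  rw [after_iff, after_iff, hp]
  exact or_congr_right (exists_congr fun v => and_congr_left fun _ =>
    ⟨fun h => h.congr hl, fun h => h.congr hl.symm⟩)

lemma passed_congr {x w w' : W} (hl : leafLabel w = leafLabel w')
    (hp : ∀ s, S.Spine x s → leafLabel s = leafLabel w →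
      (position s < position w ↔ position s < position w')) : S.Passed x w ↔ S.Passed x w' := by
  constructor
  · rintro ⟨s, hs, h, h'⟩
    exact ⟨s, hs, h.trans hl, (hp s hs h).1 h'⟩
  · rintro ⟨s, hs, h, h'⟩
    exact ⟨s, hs, h.trans hl.symm, (hp s hs (h.trans hl.symm)).2 h'⟩

variable {a b : ℝ} {γ : ℝ → W}

lemma eventually_after_left (x : W) (hγ : IsTrajectory a b γ) {t : ℝ} (ht : t ∈ Icc a b) :
    ∀ᶠ t' in 𝓝[Icc a b ∩ Iio t] t, S.After x (γ t') ↔ S.After x (γ t) := by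
  by_cases h : ∃ s, S.Spine x s ∧ leafLabel s = leafLabel (γ t)
  · obtain ⟨s, hs, hl⟩ := h
    filter_upwards [hγ.eventually_position_left ht (position s), self_mem_nhdsWithin] with t' h1 h2
    have hl' := hγ.leafLabel_eq h2.1 ht
    refine after_congr hl' (passed_congr hl' fun s' hs' h' => ?_)
    rw [← Spine.unique hs hs' (hl.trans (h'.trans hl').symm)]
    exact ⟨fun h => h.trans h1.1, h1.2⟩
  · filter_upwards [self_mem_nhdsWithin] with t' h2
    have hl' := hγ.leafLabel_eq h2.1 ht
    exact after_congr hl' (passed_congr hl' fun s hs hl => absurd ⟨s, hs, hl.trans hl'⟩ h)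

lemma eventually_after_right {x : W} (hγ : IsTrajectory a b γ) {t : ℝ} (ht : t ∈ Icc a b)
    (hcut : ¬ IsCut (γ t)) (hx : ¬ S.Spine x (γ t)) :
    ∀ᶠ t' in 𝓝[Icc a b ∩ Ioi t] t, S.After x (γ t') ↔ S.After x (γ t) := by
  by_cases h : ∃ s, S.Spine x s ∧ leafLabel s = leafLabel (γ t)
  · obtain ⟨s, hs, hl⟩ := h
    have hne : position s ≠ position (γ t) := fun h => hx (eq_of_position_eq hl h ▸ hs)
    filter_upwards [hγ.eventually_position_right ht hcut (position s), self_mem_nhdsWithin]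
      with t' h1 h2
    have hl' := hγ.leafLabel_eq h2.1 ht
    refine after_congr hl' (passed_congr hl' fun s' hs' h' => ?_)
    rw [← Spine.unique hs hs' (hl.trans (h'.trans hl').symm)]
    refine ⟨fun h => ?_, fun h => h.trans h1.1⟩
    by_contra hle
    exact lt_asymm h (h1.2 (lt_of_le_of_ne (not_lt.1 hle) hne.symm))
  · filter_upwards [self_mem_nhdsWithin] with t' h2
    have hl' := hγ.leafLabel_eq h2.1 ht
    exact after_congr hl' (passed_congr hl' fun s hs hl => absurd ⟨s, hs, hl.trans hl'⟩ h)

lemma position_bottom_le {p : F} {w : W} (h : leafLabel w = leafLabel (bottom p)) :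
    position (bottom p) ≤ position w := by
  rw [position_of_not_onCircle (not_onCircle_bottom p), position_of_not_onCircle
    ((onCircle_iff_of_leafLabel_eq h).not.2 (not_onCircle_bottom p))]
  exact (height_mem w).1

lemma le_position_top {p : F} {w : W} (h : leafLabel w = leafLabel (top p)) :
    position w ≤ position (top p) := by
  rw [position_of_not_onCircle (not_onCircle_top p), position_of_not_onCircle
    ((onCircle_iff_of_leafLabel_eq h).not.2 (not_onCircle_top p))]
  exact (height_mem w).2

/-- Nothing on a leaf precedes its bottom point, which is therefore after `x` precisely if its place
of insertion is. -/
lemma after_bottom_iff {x : W} {p : F} (hp : p ∈ D) :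
    S.After x (bottom p) ↔ S.After x (S.thick (p, 0)) := by
  have hi : S.InsertedAt (bottom p) (S.thick (p, 0)) := ⟨p, hp, Or.inl ⟨rfl, rfl⟩⟩
  rw [after_iff]
  constructor
  · rintro (⟨s, -, hl, h⟩ | ⟨v, hv, h⟩)
    · exact absurd h (not_lt.2 (position_bottom_le hl))
    · rwa [insertedAt_rightUnique hi hv]
  · exact fun h => Or.inr ⟨_, hi, h⟩

lemma exists_insertedAt_top (S : SelfInsertion) {p : F} (hp : p ∈ D) :
    ∃ s, S.InsertedAt (top p) (S.thick (p, s)) ∧ (((p.1 : ℝ) ≠ 0 ∧ s = 0) ∨ ((p.1 : ℝ) = 0 ∧ s = 1)) := by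
  by_cases h : (p.1 : ℝ) = 0
  · exact ⟨1, ⟨p, hp, Or.inr ⟨h, rfl, rfl⟩⟩, Or.inr ⟨h, rfl⟩⟩
  · exact ⟨0, ⟨p, hp, Or.inl ⟨(leafLabel_top h).symm, rfl⟩⟩, Or.inl ⟨h, rfl⟩⟩

lemma not_isCut_thick_one (S : SelfInsertion) {p : F} (hp : p ∈ D) : ¬ IsCut (S.thick (p, 1)) :=
  fun h => by
    obtain ⟨p', hp', he⟩ := S.exists_thick_of_isCut h
    exact one_ne_zero (S.eq_of_thick_eq hp hp' he).2

lemma eventually_after_top {x : W} (hx : x ∉ S.thick '' DI) (hγ : IsTrajectory a b γ) {t : ℝ}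
    (ht : t ∈ Icc a b) {p : F} (hp : p ∈ D) (h : γ t = S.thick (p, 1)) (hne : top p ≠ x) :
    ∀ᶠ t' in 𝓝[Icc a b ∩ Ioi t] t, S.After x (γ t') ↔ S.After x (top p) := by
  have hcut : ¬ IsCut (γ t) := h ▸ S.not_isCut_thick_one hp
  obtain ⟨s, hi, hs⟩ := S.exists_insertedAt_top hp
  have hle : position (S.thick (p, s)) ≤ position (S.thick (p, 1)) := by
    rcases hs with ⟨h0, rfl⟩ | ⟨-, rfl⟩
    · exact (S.exists_thick_of_position hp h0).1.le
    · exact le_rfl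
  by_cases hv : ∃ v, S.Spine x v ∧ leafLabel v = leafLabel (top p)
  · -- The spine of `x` meets the leaf of `top p`: both `top p` and the points after the inserted
    -- fibre come after `x`.
    obtain ⟨v, hv, hl⟩ := hv
    have hvt : v ≠ top p := by
      rintro rfl
      refine hne (hv.eq_of_notMem ?_)
      rintro ⟨y, hy, he⟩
      exact S.thick_avoids y hy (Or.inr ⟨p, he.symm⟩)
    have htop : S.After x (top p) := after_iff.2 (Or.inl ⟨v, hv, hl,
      lt_of_le_of_ne (le_position_top hl) fun h => hvt (eq_of_position_eq hl h)⟩)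
    filter_upwards [hγ.eventually_position_right ht hcut 0, self_mem_nhdsWithin] with t' h1 h2
    refine iff_of_true (after_iff.2 (Or.inl ⟨S.thick (p, s), ?_, ?_, ?_⟩)) htop
    · exact Relation.ReflTransGen.tail hv (hi.congr hl.symm)
    · rw [S.leafLabel_thick hp s 1, ← h, hγ.leafLabel_eq ht h2.1]
    · exact hle.trans_lt (h ▸ h1.1)
  · have hfib : ∀ s', (p.1 : ℝ) ≠ 0 ∨ s' = 1 → ¬ S.Spine x (S.thick (p, s')) := by
      rintro s' hs' h'
      obtain ⟨v, hv', ⟨hl, h0⟩ | ⟨-, hl, -⟩⟩ := h'.exists_of_thick hx hp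
      · refine hv ⟨v, hv', ?_⟩
        rw [← hl, leafLabel_top]
        exact hs'.elim id fun h1 => absurd (h0.symm.trans h1) zero_ne_one
      · exact hv ⟨v, hv', hl.symm⟩
    have htop : S.After x (top p) ↔ S.After x (S.thick (p, s)) := by
      rw [after_iff]
      constructor
      · rintro (⟨v, hv', hl, -⟩ | ⟨v, hv', h⟩)
        · exact absurd ⟨v, hv', hl⟩ hv
        · rwa [insertedAt_rightUnique hi hv']
      · exact fun h => Or.inr ⟨_, hi, h⟩
    have hends : S.After x (S.thick (p, s)) ↔ S.After x (S.thick (p, 1)) := by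
      rcases hs with ⟨h0, rfl⟩ | ⟨-, rfl⟩
      · refine after_congr (S.leafLabel_thick hp 0 1) (passed_congr (S.leafLabel_thick hp 0 1)
          fun v hv' hl => ⟨fun h => h.trans_le hle, fun h => ?_⟩)
        by_contra hge
        obtain ⟨s', rfl⟩ := (S.exists_thick_of_position hp h0).2 v hl (not_lt.1 hge) h.le
        exact hfib s' (Or.inl h0) hv'
      · rfl
    rw [htop, hends, ← h]
    exact eventually_after_right hγ ht hcut (h ▸ hfib 1 (Or.inr rfl))

lemma eventually_nhdsWithin_of_sides {t : ℝ} {A : Set ℝ} {Q : ℝ → Prop} (ht : Q t)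
    (hl : ∀ᶠ t' in 𝓝[A ∩ Iio t] t, Q t') (hr : ∀ᶠ t' in 𝓝[A ∩ Ioi t] t, Q t') :
    ∀ᶠ t' in 𝓝[A] t, Q t' := by
  rw [eventually_nhdsWithin_iff] at hl hr ⊢
  filter_upwards [hl, hr] with t' hl hr ht'
  rcases lt_trichotomy t' t with h | h | h
  · exact hl ⟨ht', h⟩
  · rwa [h]
  · exact hr ⟨ht', h⟩

/-- Removing a point `x` splits the self-inserted plug into two open parts: the points after `x`, and
the others. -/
lemma isOpen_after {x : W} (hx : x ∉ S.thick '' DI) (q : Prop) :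
    IsOpen[S.hatLeafTopology] (S.toPlug ⁻¹' {w | w ≠ x ∧ (S.After x w ↔ q)}) := by
  have hcont : ∀ {a b : ℝ} {γ : ℝ → W}, IsTrajectory a b γ → ∀ t ∈ Icc a b, γ t ≠ x →
      ∀ᶠ t' in 𝓝[Icc a b] t, γ t' ≠ x := fun hγ t ht h =>
    hγ.continuousOn t ht (isOpen_ne.mem_nhds h)
  have hne : ∀ {p : F} (s : unitInterval), p ∈ D → S.thick (p, s) ≠ x :=
    fun s hp h => hx (h ▸ S.thick_mem hp s)
  refine S.isOpen_preimage_toPlug ?_ ?_ ?_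
  · intro a b γ hγ t ht hm ⟨h1, h2⟩
    have hcut : ¬ IsCut (γ t) := fun h => by
      obtain ⟨p, hp, he⟩ := S.exists_thick_of_isCut h
      exact hm (he ▸ S.thick_mem hp 0)
    refine (hcont hγ t ht h1).and (eventually_nhdsWithin_of_sides h2 ?_ ?_)
    · filter_upwards [eventually_after_left x hγ ht] with t' h
      exact h.trans h2
    · filter_upwards [eventually_after_right hγ ht hcut fun h => h1 (h.eq_of_notMem hm)] with t' h
      exact h.trans h2
  · intro a b γ hγ t ht p hp he ⟨h1, h2⟩
    refine ((hcont hγ t ht (he ▸ hne 0 hp)).filter_mono (nhdsWithin_mono t inter_subset_left)).and ?_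
    filter_upwards [eventually_after_left x hγ ht] with t' h
    rwa [h, he, ← after_bottom_iff hp]
  · intro a b γ hγ t ht p hp he ⟨h1, h2⟩
    refine ((hcont hγ t ht (he ▸ hne 1 hp)).filter_mono (nhdsWithin_mono t inter_subset_left)).and ?_
    filter_upwards [eventually_after_top hx hγ ht hp he h1] with t' h
    rwa [h]

/-- The leaf of `x` and the leaves into which it is inserted, directly or indirectly, make up an open
set. -/
lemma isOpen_spine_leaves (x : W) :
    IsOpen[S.hatLeafTopology] (S.toPlug ⁻¹' {w | ∃ s, S.Spine x s ∧ leafLabel s = leafLabel w}) := by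
  refine S.isOpen_preimage_toPlug ?_ ?_ ?_
  · rintro a b γ hγ t ht - ⟨s, hs, hl⟩
    filter_upwards [self_mem_nhdsWithin] with t' ht'
    exact ⟨s, hs, hl.trans (hγ.leafLabel_eq ht ht')⟩
  · rintro a b γ hγ t ht p hp he ⟨s, hs, hl⟩
    filter_upwards [self_mem_nhdsWithin] with t' ht'
    refine ⟨S.thick (p, 0), Relation.ReflTransGen.tail hs ⟨p, hp, Or.inl ⟨hl.symm, rfl⟩⟩, ?_⟩
    rw [← he, hγ.leafLabel_eq ht ht'.1]
  · rintro a b γ hγ t ht p hp he ⟨v, hv, hl⟩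
    obtain ⟨s, hi, -⟩ := S.exists_insertedAt_top hp
    filter_upwards [self_mem_nhdsWithin] with t' ht'
    refine ⟨S.thick (p, s), Relation.ReflTransGen.tail hv (hi.congr hl.symm), ?_⟩
    rw [S.leafLabel_thick hp s 1, ← he, hγ.leafLabel_eq ht ht'.1]

lemma comparable_of_spine {x y : W} (hy : y ∉ S.thick '' DI) (hne : y ≠ x)
    (h : ∃ s, S.Spine x s ∧ leafLabel s = leafLabel y) : S.After x y ∨ S.After y x := by
  obtain ⟨s, hs, hl⟩ := h
  rcases lt_trichotomy (position s) (position y) with h | h | h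
  · exact Or.inl ⟨y, Relation.ReflTransGen.refl, s, hs, hl, h⟩
  · obtain rfl := eq_of_position_eq hl h
    exact absurd (hs.eq_of_notMem hy) hne
  · exact Or.inr ⟨s, hs, y, Relation.ReflTransGen.refl, hl.symm, h⟩

end SelfInsertion

/-! ### Circles -/

lemma isPreconnected_compl_singleton_circle (c : Circle) : IsPreconnected ({c}ᶜ : Set Circle) := by
  set θ : ℝ := Complex.arg c
  have hθ : Circle.exp θ = c := Circle.exp_arg c
  have : ({c}ᶜ : Set Circle) = Circle.exp '' Ioo θ (θ + 2 * Real.pi) := by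
    ext z
    rw [mem_compl_singleton_iff]
    constructor
    · intro hz
      obtain ⟨t, ht, he⟩ := Circle.periodic_exp.exists_mem_Ico Real.two_pi_pos (Complex.arg z) θ
      rw [Circle.exp_arg] at he
      exact ⟨t, ⟨lt_of_le_of_ne ht.1 fun h => hz (by rw [he, ← h, hθ]), ht.2⟩, he.symm⟩
    · rintro ⟨t, ht, rfl⟩ h
      rw [← hθ, Circle.exp_eq_exp] at h
      obtain ⟨m, hm⟩ := h
      have hpi := Real.two_pi_pos
      have h0 : (0 : ℝ) < m := by nlinarith [ht.1]
      have h1 : (m : ℝ) < 1 := by nlinarith [ht.2]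
      have h0' : 0 < m := by exact_mod_cast h0
      have h1' : m < 1 := by exact_mod_cast h1
      omega
  rw [this]
  exact isPreconnected_Ioo.image _ Circle.exp.continuous.continuousOn

namespace SelfInsertion

variable (S : SelfInsertion)

/-- There is no simple closed curve in the leaf topology. -/
theorem not_injective_circle {f : Circle → S.Hat}
    (hf : @Continuous _ _ _ S.hatLeafTopology f) : ¬ Function.Injective f := by
  intro hinj
  have hopen : ∀ {U : Set S.Hat}, IsOpen[S.hatLeafTopology] U → IsOpen (f ⁻¹' U) := fun hU =>
    (@continuous_def _ _ _ S.hatLeafTopology _).1 hf _ hU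
  set g : Circle → W := fun c => S.toPlug (f c)
  have hg : Function.Injective g := S.toPlug_injective.comp hinj
  have hgn : ∀ c, g c ∉ S.thick '' DI := fun c => S.toPlug_notMem _
  -- As `{c}ᶜ` is connected, either all its points or none come after `c`.
  have hall : ∀ c d e, d ≠ c → e ≠ c → S.After (g c) (g d) → S.After (g c) (g e) := by
    intro c d e hd he hcd
    by_contra hce
    obtain ⟨y, -, hy1, hy2⟩ := isPreconnected_compl_singleton_circle c _ _
      (hopen (isOpen_after (hgn c) True)) (hopen (isOpen_after (hgn c) False))
      (fun y hy => by
        by_cases h : S.After (g c) (g y)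
        · exact Or.inl ⟨hg.ne hy, iff_of_true h trivial⟩
        · exact Or.inr ⟨hg.ne hy, iff_of_false h id⟩)
      ⟨d, hd, hg.ne hd, iff_of_true hcd trivial⟩ ⟨e, he, hg.ne he, iff_of_false hce id⟩
    exact hy2.2.1 (hy1.2.2 trivial)
  have : Nontrivial Circle := ⟨1, Circle.exp Real.pi, fun h => Circle.exp_pi_ne_one h.symm⟩
  -- Every point of the circle is comparable to a nearby one other than a prescribed one.
  have hnear : ∀ c m, ∃ d, d ≠ c ∧ d ≠ m ∧ (S.After (g c) (g d) ∨ S.After (g d) (g c)) := by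
    intro c m
    have hV := (hopen (isOpen_spine_leaves (S := S) (g c))).mem_nhds
      (show c ∈ _ from ⟨g c, Relation.ReflTransGen.refl, rfl⟩)
    obtain ⟨d, hd, hd'⟩ := (infinite_of_mem_nhds c hV).exists_notMem_finite (toFinite {c, m})
    simp only [mem_insert_iff, mem_singleton_iff, not_or] at hd'
    exact ⟨d, hd'.1, hd'.2, comparable_of_spine (hgn d) (hg.ne hd'.1) hd⟩
  -- Hence some point `c` precedes all others. Only one point can do so, but a point other than `c`
  -- and a point comparable to it, also other than `c`, yield a second one.
  obtain ⟨c, hc⟩ : ∃ c, ∀ e, e ≠ c → S.After (g c) (g e) := by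
    obtain ⟨d, hd, -, h | h⟩ := hnear 1 1
    · exact ⟨1, fun e he => hall 1 d e hd he h⟩
    · exact ⟨d, fun e he => hall d 1 e hd.symm he h⟩
  obtain ⟨d, hd, -⟩ := hnear c c
  obtain ⟨e, hed, hec, h | h⟩ := hnear d c
  · exact after_asymm (hc d hd) (hall d e c hed hd.symm h)
  · exact after_asymm (hc e hec) (hall e d c hed.symm hec.symm h)

end SelfInsertion

end

end AnalyticPlug

/-- Whatever attaching map and extension of `σ` are chosen, and whatever part `Y` of the resulting
space is kept (in particular the part cut out by surfaces transverse to the foliation that approximate the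
stair-like top and bottom), the self-inserted foliation has no circular leaves. -/
theorem theorem6p1 (S : AnalyticPlug.SelfInsertion) (Y : Set S.Hat) :
    ¬ ∃ L : Set (S.Part Y), S.IsCircularLeaf Y L := by
  rintro ⟨L, -, ⟨e⟩⟩
  have hv : @Continuous (S.Part Y) S.Hat _ S.hatLeafTopology (fun y => y.1) :=
    @continuous_induced_dom _ _ (fun y : S.Part Y => y.1) S.hatLeafTopology
  refine S.not_injective_circle (f := fun c => (e.symm c).1.1) ?_ ?_
  · exact @Continuous.comp _ _ _ _ _ S.hatLeafTopology _ _ hv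
      (continuous_subtype_val.comp e.symm.continuous)
  · exact fun c d h => e.symm.injective (Subtype.ext (Subtype.ext h))
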